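/- Let $M$ be a compact smooth manifold with corners, and let $Map(M,U)=\varinjlim_n Map(M,U(n))$, where $Map(M,U(n))$ is the set of smooth maps from $M$ to the unitary group $U(n)$ and $U(n)$ is included in $U(n+1)$ by $u\mapsto u\oplus 1$. For a path $\nabla^s=d+A^s$ $(0\le s\le 1)$ of connections on the trivial bundle $\mathbb C^N\times M\to M$ with curvatures $R^s=dA^s+A^s\wedge A^s$, put $$CS(\nabla^s)=\mathrm{Tr}\int_0^1\sum_{n\ge 0}\frac{1}{(2\pi i)^{n+1}}\frac{1}{(n+1)!}\sum_{i=0}^{n}(R^s)^{i}\wedge\tfrac{\partial A^s}{\partial s}\wedge (R^s)^{n-i}\,ds .$$ For a smooth map $g$ from a manifold with corners to $U(N)$ let $Ch(g)=CS(d+s\,g^{-1}dg)$ be its odd Chern form. For a smooth path of maps $f_t\in Map(M\times[a,b],U(N))$, $a<b$, let its odd Chern–Simons form be $CS(f_t)=\int_{[a,b]}Ch(f_t)$, where $\int_{[a,b]}$ is integration along the fiber of $M\times[a,b]\to M$. Fix real numbers $a<b$ (for instance $[a,b]=[0,1]$ or $[a,b]=[0,\pi/2]$). (1) For any $g\in Map(M,U(n))$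 and $h\in Map(M,U(m))$ (with $n,m$ arbitrary) there is a path $f_t\in Map(M\times[a,b],U)$, i.e. in $Map(M\times[a,b],U(N))$ for some $N$, such that, as elements of $Map(M,U)$, $$f_a=g\oplus h,\qquad f_b=h\oplus g,\qquad\text{and}\qquad CS(f_t)=0 .$$ (2) For any $g\in Map(M,U(n))$ there is a path $k_t\in Map(M\times[a,b],U)$ such that, as elements of $Map(M,U)$, $$k_a=g\oplus g^{-1},\qquad k_b=1,\qquad\text{and}\qquad CS(k_t)=0 .$$ Here $g\oplus h$ is the block sum with values in $U(n+m)$, $g^{-1}$ is the pointwise inverse, $1$ is the constant map to the identity, and $CS=0$ means that the differential form vanishes identically, in all degrees. -/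

import Mathlib

open scoped Manifold ContDiff Nat

noncomputable section

namespace OddK

/-! ### Inhomogeneous complex-valued alternating forms on a real vector space -/

section Forms

variable {E : Type*} [NormedAddCommGroup E] [NormedSpace ℝ E]

variable (E) in
/-- Inhomogeneous complex-valued alternating forms on `E`; the value `η k` is the component
of degree `k`. -/
abbrev Form : Type _ := ∀ k : ℕ, E [⋀^Fin k]→L[ℝ] ℂ

/-- The form that is homogeneous of degree `k`, equal to `α`. -/
def Form.homogeneous {k : ℕ} (α : E [⋀^Fin k]→L[ℝ] ℂ) : Form E :=
  Pi.single k α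

/-- The form of degree zero given by a number. -/
def Form.const (c : ℂ) : Form E :=
  Form.homogeneous (ContinuousAlternatingMap.constOfIsEmpty ℝ E (Fin 0) c)

/-- The form of degree one given by a linear functional. -/
def Form.ofLinear (l : E →L[ℝ] ℂ) : Form E :=
  Form.homogeneous (ContinuousAlternatingMap.ofSubsingleton ℝ E ℂ (0 : Fin 1) l)

/-- The multilinear map `v ↦ α (v₁, …, v_p) * β (v_{p+1}, …, v_{p+q})`. -/
def tensorMul {p q : ℕ} (α : E [⋀^Fin p]→L[ℝ] ℂ) (β : E [⋀^Fin q]→L[ℝ] ℂ) :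
    ContinuousMultilinearMap ℝ (fun _ : Fin (p + q) => E) ℂ where
  toFun v := α (fun i => v (Fin.castAdd q i)) * β (fun j => v (Fin.natAdd p j))
  map_update_add' := by
    intro inst v i x y
    obtain rfl : inst = instDecidableEqFin _ := Subsingleton.elim _ _
    induction i using Fin.addCases with
    | left i =>
      have h1 : ∀ z : E, (fun a : Fin p => Function.update v (Fin.castAdd q i) z (Fin.castAdd q a))
          = Function.update (fun a => v (Fin.castAdd q a)) i z := by
        intro z; ext a; by_cases h : a = i
        · subst h; simp
        · simp [Function.update_of_ne, h]
      have h2 : ∀ z : E, (fun a : Fin q => Function.update v (Fin.castAdd q i) z (Fin.natAdd p a))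
          = fun a => v (Fin.natAdd p a) := by
        intro z; ext a; rw [Function.update_of_ne]
        intro h; simp only [Fin.ext_iff, Fin.val_natAdd, Fin.val_castAdd] at h; omega
      simp only [h1, h2, ContinuousAlternatingMap.map_update_add, add_mul]
    | right i =>
      have h1 : ∀ z : E, (fun a : Fin q => Function.update v (Fin.natAdd p i) z (Fin.natAdd p a))
          = Function.update (fun a => v (Fin.natAdd p a)) i z := by
        intro z; ext a; by_cases h : a = i
        · subst h; simp
        · simp [Function.update_of_ne, h]
      have h2 : ∀ z : E, (fun a : Fin p => Function.update v (Fin.natAdd p i) z (Fin.castAdd q a))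
          = fun a => v (Fin.castAdd q a) := by
        intro z; ext a; rw [Function.update_of_ne]
        intro h; simp only [Fin.ext_iff, Fin.val_natAdd, Fin.val_castAdd] at h; omega
      simp only [h1, h2, ContinuousAlternatingMap.map_update_add, mul_add]
  map_update_smul' := by
    intro inst v i c x
    obtain rfl : inst = instDecidableEqFin _ := Subsingleton.elim _ _
    induction i using Fin.addCases with
    | left i =>
      have h1 : ∀ z : E, (fun a : Fin p => Function.update v (Fin.castAdd q i) z (Fin.castAdd q a))
          = Function.update (fun a => v (Fin.castAdd q a)) i z := by
        intro z; ext a; by_cases h : a = i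
        · subst h; simp
        · simp [Function.update_of_ne, h]
      have h2 : ∀ z : E, (fun a : Fin q => Function.update v (Fin.castAdd q i) z (Fin.natAdd p a))
          = fun a => v (Fin.natAdd p a) := by
        intro z; ext a; rw [Function.update_of_ne]
        intro h; simp only [Fin.ext_iff, Fin.val_natAdd, Fin.val_castAdd] at h; omega
      simp only [h1, h2, ContinuousAlternatingMap.map_update_smul, smul_mul_assoc]
    | right i =>
      have h1 : ∀ z : E, (fun a : Fin q => Function.update v (Fin.natAdd p i) z (Fin.natAdd p a))
          = Function.update (fun a => v (Fin.natAdd p a)) i z := by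
        intro z; ext a; by_cases h : a = i
        · subst h; simp
        · simp [Function.update_of_ne, h]
      have h2 : ∀ z : E, (fun a : Fin p => Function.update v (Fin.natAdd p i) z (Fin.castAdd q a))
          = fun a => v (Fin.castAdd q a) := by
        intro z; ext a; rw [Function.update_of_ne]
        intro h; simp only [Fin.ext_iff, Fin.val_natAdd, Fin.val_castAdd] at h; omega
      simp only [h1, h2, ContinuousAlternatingMap.map_update_smul, mul_smul_comm]
  cont := by
    refine (α.cont.comp ?_).mul (β.cont.comp ?_) <;> fun_prop

/-- The wedge product of a `p`-form and a `q`-form, as a `k`-form where `k = p + q`: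
`(α ∧ β)(v) = 1 / (p! q!) ∑_σ sgn σ • α (v_{σ 1}, …, v_{σ p}) β (v_{σ (p+1)}, …, v_{σ (p+q)})`. -/
def wedge {p q k : ℕ} (hk : p + q = k) (α : E [⋀^Fin p]→L[ℝ] ℂ) (β : E [⋀^Fin q]→L[ℝ] ℂ) :
    E [⋀^Fin k]→L[ℝ] ℂ :=
  ((p ! * q ! : ℝ))⁻¹ •
    ContinuousMultilinearMap.alternatization ((tensorMul α β).domDomCongr (finCongr hk))

/-- The wedge product of inhomogeneous forms, `(α ∧ β)_k = ∑_{p + q = k} α_p ∧ β_q`. -/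
instance : Mul (Form E) where
  mul α β := fun k => ∑ p : Fin (k + 1),
    wedge (Nat.add_sub_of_le (Nat.lt_succ_iff.1 p.2)) (α p) (β (k - p))

instance : One (Form E) where
  one := Form.const 1

/-- Powers of a square matrix of forms; the product of matrices is formed with the wedge
product of the entries. -/
def matPow {N : ℕ} (A : Matrix (Fin N) (Fin N) (Form E)) : ℕ → Matrix (Fin N) (Fin N) (Form E)
  | 0 => 1
  | k + 1 => matPow A k * A

end Forms

section Manifold

variable {E : Type*} [NormedAddCommGroup E] [NormedSpace ℝ E]
  {H : Type*} [TopologicalSpace H] (I : ModelWithCorners ℝ E H)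
  {M : Type*} [TopologicalSpace M] [ChartedSpace H M]

/-! ### Differential forms on a manifold with corners

A differential form on `M` is a function `M → Form E`: the tangent space `TangentSpace I p` is by
definition `E`, identified with the tangent space through the preferred chart at `p`. -/

/-- The exterior derivative of a differential form: in the preferred chart at `p`, pull the form
back along the inverse of the chart and take the exterior derivative on the model. -/
def extD (η : M → Form E) : M → Form E := fun p k =>
  match k with
  | 0 => 0
  | k + 1 => extDerivWithin
      (fun y : E => (η ((extChartAt I p).symm y) k).compContinuousLinearMap
        (mfderivWithin 𝓘(ℝ, E) I (extChartAt I p).symm (Set.range I) y : E →L[ℝ] E))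
      (Set.range I) (extChartAt I p p)

/-- The curvature `R = dA + A ∧ A` of the connection `d + A` on the trivial bundle of rank `N`,
where `A` is a matrix of one-forms. -/
def curvature {N : ℕ} (A : M → Matrix (Fin N) (Fin N) (Form E)) :
    M → Matrix (Fin N) (Fin N) (Form E) := fun p =>
  Matrix.of (fun i j => extD I (fun q => A q i j) p) + A p * A p

/-- The derivative `∂/∂s A^s` of a path of matrices of forms. -/
def pathDeriv {N : ℕ} (A : ℝ → M → Matrix (Fin N) (Fin N) (Form E)) (s : ℝ) :
    M → Matrix (Fin N) (Fin N) (Form E) := fun p =>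
  Matrix.of fun i j => (fun k => deriv (fun r : ℝ => A r p i j k) s : Form E)

/-- The Chern-Simons form of the path `∇^s = d + A^s`, `0 ≤ s ≤ 1`, of connections on the trivial
bundle of rank `N`:
`Tr ∫₀¹ ∑_{n ≥ 0} 1 / (2πi)^(n+1) 1 / (n+1)! ∑_{i=0}^n R^s ∧ … ∧ (∇^s)' ∧ … ∧ R^s ds`, where the
`i`th summand has `i` factors `R^s` before `(∇^s)'` and `n - i` factors after it.
The `n`th summand is homogeneous of degree `2n+1`, so only those with `n ≤ k` matter for the
component of degree `k`. -/
def connCS {N : ℕ} (A : ℝ → M → Matrix (Fin N) (Fin N) (Form E)) : M → Form E := fun p =>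
  Matrix.trace (Matrix.of fun a b => (fun k => ∫ s in (0 : ℝ)..1,
    (∑ n ∈ Finset.range (k + 1),
      (1 / (2 * (Real.pi : ℂ) * Complex.I) ^ (n + 1) * (1 / ((n + 1)! : ℂ))) •
        ∑ i ∈ Finset.range (n + 1),
          matPow (curvature I (A s) p) i * pathDeriv A s p *
            matPow (curvature I (A s) p) (n - i)) a b k : Form E))

/-! ### Maps into the unitary groups -/

variable (M) in
/-- The set `Map(M, U(n))` of smooth maps from `M` to the unitary group `U(n)`; smoothness is
smoothness of all the matrix entries. -/
structure UMap (n : ℕ) where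
  toFun : M → Matrix.unitaryGroup (Fin n) ℂ
  smooth : ∀ i j, ContMDiff I 𝓘(ℝ, ℂ) ∞ fun p => (toFun p : Matrix (Fin n) (Fin n) ℂ) i j

instance {n : ℕ} : CoeFun (UMap I M n) (fun _ => M → Matrix.unitaryGroup (Fin n) ℂ) :=
  ⟨UMap.toFun⟩

/-- The image in `U = colim U(n)` of an `n × n` matrix, as an infinite matrix: the given matrix in
the upper left corner, completed by the identity. -/
def stable {n : ℕ} (a : Matrix.unitaryGroup (Fin n) ℂ) : Matrix ℕ ℕ ℂ :=
  Matrix.of fun i j =>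
    if h : i < n ∧ j < n then (a : Matrix (Fin n) (Fin n) ℂ) ⟨i, h.1⟩ ⟨j, h.2⟩
    else if i = j then 1 else 0

variable {I}

/-- The constant map to the identity. -/
def UMap.one (n : ℕ) : UMap I M n where
  toFun _ := 1
  smooth _ _ := contMDiff_const

/-- The pointwise inverse `g⁻¹` of a map into `U(n)`. -/
def UMap.inv {n : ℕ} (g : UMap I M n) : UMap I M n where
  toFun p := (g p)⁻¹
  smooth i j := by
    have h := (Complex.conjCLE.contDiff (n := ∞)).contMDiff.comp (g.smooth j i)
    exact h

/-- The block sum of unitary matrices. -/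
def blockSum {n m : ℕ} (a : Matrix.unitaryGroup (Fin n) ℂ) (b : Matrix.unitaryGroup (Fin m) ℂ) :
    Matrix.unitaryGroup (Fin (n + m)) ℂ :=
  ⟨Matrix.reindex finSumFinEquiv finSumFinEquiv
      (Matrix.fromBlocks (a : Matrix (Fin n) (Fin n) ℂ) 0 0 (b : Matrix (Fin m) (Fin m) ℂ)), by
    rw [Matrix.mem_unitaryGroup_iff, Matrix.star_eq_conjTranspose, Matrix.conjTranspose_reindex,
      Matrix.reindex_apply, Matrix.reindex_apply, Matrix.submatrix_mul_equiv,
      Matrix.fromBlocks_conjTranspose, Matrix.fromBlocks_multiply]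
    have ha := Matrix.mem_unitaryGroup_iff.1 a.2
    have hb := Matrix.mem_unitaryGroup_iff.1 b.2
    rw [Matrix.star_eq_conjTranspose] at ha hb
    simp [ha, hb]⟩

/-- The block sum `g ⊕ h` of two maps. -/
def UMap.blockSum {n m : ℕ} (g : UMap I M n) (h : UMap I M m) : UMap I M (n + m) where
  toFun p := OddK.blockSum (g p) (h p)
  smooth i j := by
    induction i using Fin.addCases with
    | left i =>
      induction j using Fin.addCases with
      | left j => simpa [OddK.blockSum] using g.smooth i j
      | right j => simpa [OddK.blockSum] using contMDiff_const
    | right i =>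
      induction j using Fin.addCases with
      | left j => simpa [OddK.blockSum] using contMDiff_const
      | right j => simpa [OddK.blockSum] using h.smooth i j

/-- The matrix of one-forms `g⁻¹ dg`. -/
def UMap.mc {n : ℕ} (g : UMap I M n) : M → Matrix (Fin n) (Fin n) (Form E) := fun p =>
  (((g p)⁻¹ : Matrix.unitaryGroup (Fin n) ℂ) : Matrix (Fin n) (Fin n) ℂ).map Form.const *
    Matrix.of fun i j => Form.ofLinear (E := E)
      (mfderiv I 𝓘(ℝ, ℂ) (fun q => (g q : Matrix (Fin n) (Fin n) ℂ) i j) p)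

/-- The odd Chern form `Ch(g)` of a map into `U(n)`: the Chern-Simons form of the path of
connections `d + s g⁻¹ dg`, `0 ≤ s ≤ 1`. -/
def UMap.Ch {n : ℕ} (g : UMap I M n) : M → Form E :=
  connCS I fun s p => s • g.mc p

/-! ### Paths of maps, integration along the fiber, and the odd Chern-Simons form -/

section Paths

variable {a b : ℝ} [Fact (a < b)]

variable (I M a b) in
/-- `Map(M × [a, b], U(n))`, where `M × [a, b]` is the product manifold with corners. -/
abbrev UPath (n : ℕ) : Type _ := UMap (I.prod (𝓡∂ 1)) (M × Set.Icc a b) n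

/-- Integration along the fiber of `M × [a, b] → M`:
`(∫η)_p (v₁, …, v_k) = ∫_a^b η_{(p,t)} (∂/∂t, v₁, …, v_k) dt`; on `[a, b]` the map
`Set.projIcc` is the identity. -/
def fiberIntegral (η : M × Set.Icc a b → Form (E × EuclideanSpace ℝ (Fin 1))) : M → Form E :=
  fun p k => ∫ t in a..b,
    let τ : Set.Icc a b := Set.projIcc a b (Fact.out : a < b).le t
    ((η (p, τ) (k + 1)).curryLeft
        ((0, oneTangentSpaceIcc τ) : E × EuclideanSpace ℝ (Fin 1))).compContinuousLinearMap
      (ContinuousLinearMap.inl ℝ E (EuclideanSpace ℝ (Fin 1)))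

/-- The odd Chern-Simons form `CS(f_t) = ∫_{[a,b]} Ch(f_t)` of a path of maps into `U(n)`. -/
def UPath.CS {n : ℕ} (f : UPath I M a b n) : M → Form E :=
  fiberIntegral (UMap.Ch f)

/-- The path `f` starts, at `t = a`, at the map `g`, as elements of the stable group `U`. -/
def UPath.StartsAt {N n : ℕ} (f : UPath I M a b N) (g : UMap I M n) : Prop :=
  ∀ p, stable (f (p, ⟨a, le_rfl, (Fact.out : a < b).le⟩)) = stable (g p)

/-- The path `f` ends, at `t = b`, at the map `g`, as elements of the stable group `U`. -/
def UPath.EndsAt {N n : ℕ} (f : UPath I M a b N) (g : UMap I M n) : Prop :=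
  ∀ p, stable (f (p, ⟨b, (Fact.out : a < b).le, le_rfl⟩)) = stable (g p)

end Paths

end Manifold

end OddK

end

/-! Write `ω = g⁻¹ dg`. The Maurer-Cartan equation `dω = -ω ∧ ω` gives the connection `d + s ω` the
curvature `(s² - s) ω²`, so all `n + 1` summands of the `n`th Chern-Simons term coincide and `Ch(g)`
is a combination of the forms `Tr ω^(2n+1)` with numerical coefficients (`UMap.Ch_apply`).
Integrating over `[a, b]` inserts `∂/∂t` into one slot, and cyclicity of the trace moves that slot
to the front. Hence `CS(f_t) = 0` as soon as `Tr (f⁻¹ ∂f/∂t · (f⁻¹ df)(v₁) ⋯ (f⁻¹ df)(v_{2n}))`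
vanishes for all `v₁, …, v_{2n}` tangent to `M` (`UPath.CS_eq_zero`). The values of the coefficients
play no role.

Both paths live in 2 × 2 block matrices. After a common conjugation the time derivative is block
off-diagonal and every even word in the space derivatives is block diagonal, so the product has zero
trace (`UPath.CS_ofBlocks_eq_zero`).

For (1), `h ⊕ g` is `g ⊕ h` conjugated by a permutation matrix `Q`. Stabilize to `D = (g ⊕ h) ⊕ 1`
and take `X D X⁻¹`, where `X` runs through constant unitary matrices from `1` to `Q ⊕ Q⁻¹` with `X⁻¹
X'` off-diagonal at all times (`exists_path_conj`).

For (2), take `(g ⊕ 1) X (1 ⊕ g⁻¹) X⁻¹`, where `X` rotates one summand into the other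
(`exists_path_blockSum_inv`). Single space derivatives are not block diagonal here, but a product of
two is (`skewRot_mul_skewRot`); the parity of the word is what makes the trace vanish. -/

noncomputable section

namespace OddK

/-! ### Wedge powers of a matrix of one-forms as antisymmetrized words -/

section Forms

variable {E : Type*} [NormedAddCommGroup E] [NormedSpace ℝ E]

theorem wedge_apply {p q : ℕ} (α : E [⋀^Fin p]→L[ℝ] ℂ) (β : E [⋀^Fin q]→L[ℝ] ℂ)
    (v : Fin (p + q) → E) :
    wedge rfl α β v = ((p ! * q ! : ℝ))⁻¹ • ∑ π : Equiv.Perm (Fin (p + q)), Equiv.Perm.sign π •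
      (α (fun i => v (π (Fin.castAdd q i))) * β (fun j => v (π (Fin.natAdd p j)))) := by
  simp only [wedge, ContinuousAlternatingMap.smul_apply,
    ContinuousMultilinearMap.alternatization_apply_apply]
  rfl

@[simp]
theorem wedge_zero_left {p q k : ℕ} (hk : p + q = k) (β : E [⋀^Fin q]→L[ℝ] ℂ) :
    wedge hk (0 : E [⋀^Fin p]→L[ℝ] ℂ) β = 0 := by
  subst hk
  ext v
  simp [wedge_apply]

@[simp]
theorem wedge_zero_right {p q k : ℕ} (hk : p + q = k) (α : E [⋀^Fin p]→L[ℝ] ℂ) :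
    wedge hk α (0 : E [⋀^Fin q]→L[ℝ] ℂ) = 0 := by
  subst hk
  ext v
  simp [wedge_apply]

theorem wedge_smul_smul {p q k : ℕ} (hk : p + q = k) (r s : ℝ) (α : E [⋀^Fin p]→L[ℝ] ℂ)
    (β : E [⋀^Fin q]→L[ℝ] ℂ) : wedge hk (r • α) (s • β) = (r * s) • wedge hk α β := by
  subst hk
  ext v
  simp only [wedge_apply, ContinuousAlternatingMap.smul_apply, smul_mul_smul_comm]
  simp only [smul_comm _ (r * s), ← Finset.smul_sum]

theorem Form.mul_apply (α β : Form E) (k : ℕ) :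
    (α * β) k = ∑ p : Fin (k + 1),
      wedge (Nat.add_sub_of_le (Nat.lt_succ_iff.1 p.2)) (α p) (β (k - p)) := rfl

theorem Form.smul_mul_smul (r s : ℝ) (α β : Form E) :
    (r • α) * (s • β) = (r * s) • (α * β) := by
  funext k
  simp only [Form.mul_apply, Pi.smul_apply, wedge_smul_smul, Finset.smul_sum]

theorem Form.homogeneous_mul {p q : ℕ} (α : E [⋀^Fin p]→L[ℝ] ℂ) (β : E [⋀^Fin q]→L[ℝ] ℂ) :
    Form.homogeneous α * Form.homogeneous β = Form.homogeneous (wedge rfl α β) := by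
  funext k
  rw [Form.mul_apply]
  by_cases hk : p + q = k
  · subst hk
    rw [Finset.sum_eq_single (⟨p, by omega⟩ : Fin (p + q + 1))]
    · have key : ∀ (r : ℕ) (hr : p + r = p + q),
          wedge hr (Form.homogeneous α p) (Form.homogeneous β r) = wedge rfl α β := by
        intro r hr
        obtain rfl : r = q := by omega
        simp [Form.homogeneous]
      rw [key]
      simp [Form.homogeneous]
    · intro b _ hb
      have : (b : ℕ) ≠ p := fun h => hb (Fin.ext h)
      simp [Form.homogeneous, Pi.single_eq_of_ne this]
    · simp
  · rw [Finset.sum_eq_zero]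
    · simp [Form.homogeneous, Pi.single_eq_of_ne (Ne.symm hk)]
    · intro b _
      by_cases hb : (b : ℕ) = p
      · have : k - b ≠ q := by omega
        simp [Form.homogeneous, Pi.single_eq_of_ne this]
      · simp [Form.homogeneous, Pi.single_eq_of_ne hb]

theorem Form.homogeneous_sum {ι : Type*} (s : Finset ι) {k : ℕ} (α : ι → E [⋀^Fin k]→L[ℝ] ℂ) :
    ∑ i ∈ s, Form.homogeneous (α i) = Form.homogeneous (∑ i ∈ s, α i) :=
  (map_sum (AddMonoidHom.single (fun k : ℕ => E [⋀^Fin k]→L[ℝ] ℂ) k) α s).symm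

/-- The wedge product of two alternatizations is the alternatization of the tensor product. -/
theorem wedge_alternatization {p q : ℕ} (a : ContinuousMultilinearMap ℝ (fun _ : Fin p => E) ℂ)
    (b : ContinuousMultilinearMap ℝ (fun _ : Fin q => E) ℂ) (v : Fin (p + q) → E) :
    wedge rfl (ContinuousMultilinearMap.alternatization a)
      (ContinuousMultilinearMap.alternatization b) v =
    ∑ π : Equiv.Perm (Fin (p + q)), Equiv.Perm.sign π •
      (a (fun i => v (π (Fin.castAdd q i))) * b (fun j => v (π (Fin.natAdd p j)))) := by
  rw [wedge_apply]
  have key : ∀ (σ : Equiv.Perm (Fin p)) (τ : Equiv.Perm (Fin q)),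
      ∑ π : Equiv.Perm (Fin (p + q)), Equiv.Perm.sign π •
        ((Equiv.Perm.sign σ • a (fun i => v (π (Fin.castAdd q (σ i))))) *
          (Equiv.Perm.sign τ • b (fun j => v (π (Fin.natAdd p (τ j)))))) =
      ∑ π : Equiv.Perm (Fin (p + q)), Equiv.Perm.sign π •
        (a (fun i => v (π (Fin.castAdd q i))) * b (fun j => v (π (Fin.natAdd p j)))) := by
    intro σ τ
    -- The inner permutations combine into a block permutation `ρ`. Substituting `π ↦ π ρ` absorbs
    -- them together with their signs, so each of the `p! q!` pairs `(σ, τ)` contributes the same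
    -- sum and the normalization of `wedge` cancels.
    set ρ : Equiv.Perm (Fin (p + q)) := finSumFinEquiv.permCongr (Equiv.Perm.sumCongr σ τ) with hρ
    have hsign : Equiv.Perm.sign ρ = Equiv.Perm.sign σ * Equiv.Perm.sign τ := by
      rw [hρ, Equiv.Perm.sign_permCongr, Equiv.Perm.sign_sumCongr]
    have h1 : ∀ i, Fin.castAdd q (σ i) = ρ (Fin.castAdd q i) := by intro i; simp [hρ]
    have h2 : ∀ j, Fin.natAdd p (τ j) = ρ (Fin.natAdd p j) := by intro i; simp [hρ]
    rw [← Equiv.sum_comp (Equiv.mulRight ρ) (fun π : Equiv.Perm (Fin (p + q)) =>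
      Equiv.Perm.sign π •
        (a (fun i => v (π (Fin.castAdd q i))) * b (fun j => v (π (Fin.natAdd p j)))))]
    refine Finset.sum_congr rfl fun π _ => ?_
    simp only [h1, h2, Equiv.coe_mulRight, Equiv.Perm.mul_apply, map_mul, hsign, smul_mul_smul_comm,
      mul_smul]
  simp only [ContinuousMultilinearMap.alternatization_apply_apply, Function.comp_def,
    Finset.sum_mul_sum, Finset.smul_sum (N := ℂ) (M := ℤˣ)]
  rw [Finset.sum_comm]
  have : ∀ σ : Equiv.Perm (Fin p), ∑ π : Equiv.Perm (Fin (p + q)), ∑ τ : Equiv.Perm (Fin q),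
      Equiv.Perm.sign π •
        ((Equiv.Perm.sign σ • a (fun i => v (π (Fin.castAdd q (σ i))))) *
          (Equiv.Perm.sign τ • b (fun j => v (π (Fin.natAdd p (τ j)))))) =
      (q ! : ℝ) • ∑ π : Equiv.Perm (Fin (p + q)), Equiv.Perm.sign π •
        (a (fun i => v (π (Fin.castAdd q i))) * b (fun j => v (π (Fin.natAdd p j)))) := by
    intro σ
    rw [Finset.sum_comm]
    simp only [key, Finset.sum_const, Finset.card_univ, Fintype.card_perm, Fintype.card_fin]
    rw [Nat.cast_smul_eq_nsmul]
  simp only [this, Finset.sum_const, Finset.card_univ, Fintype.card_perm, Fintype.card_fin]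
  rw [← Nat.cast_smul_eq_nsmul ℝ, smul_smul, smul_smul, mul_assoc, inv_mul_cancel₀, one_smul]
  positivity

variable {N : ℕ}

/-- The multilinear map `v ↦ (L v₁ ⋯ L v_k)ᵢⱼ`. -/
def wordEntry (L : E →L[ℝ] Matrix (Fin N) (Fin N) ℂ) (k : ℕ) (i j : Fin N) :
    ContinuousMultilinearMap ℝ (fun _ : Fin k => E) ℂ :=
  (ContinuousLinearMap.mk (Matrix.entryLinearMap ℝ ℂ i j)
      (by exact continuous_apply_apply i j)).compContinuousMultilinearMap
    ((ContinuousMultilinearMap.mkPiAlgebraFin ℝ k (Matrix (Fin N) (Fin N) ℂ)).compContinuousLinearMap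
      fun _ => L)

theorem wordEntry_apply (L : E →L[ℝ] Matrix (Fin N) (Fin N) ℂ) (k : ℕ) (i j : Fin N)
    (v : Fin k → E) : wordEntry L k i j v = (List.ofFn fun r => L (v r)).prod i j := by
  simp only [wordEntry, ContinuousLinearMap.compContinuousMultilinearMap_coe, Function.comp_apply,
    ContinuousMultilinearMap.compContinuousLinearMap_apply,
    ContinuousMultilinearMap.mkPiAlgebraFin_apply]
  rfl

/-- The `k`th power of a matrix `L` of one-forms, as a matrix of alternating forms. -/
def wordForm (L : E →L[ℝ] Matrix (Fin N) (Fin N) ℂ) (k : ℕ) : Matrix (Fin N) (Fin N) (Form E) :=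
  Matrix.of fun i j => Form.homogeneous (ContinuousMultilinearMap.alternatization (wordEntry L k i j))

theorem wordForm_apply_apply (L : E →L[ℝ] Matrix (Fin N) (Fin N) ℂ) (k : ℕ) (i j : Fin N)
    (v : Fin k → E) : wordForm L k i j k v =
      ∑ σ : Equiv.Perm (Fin k), Equiv.Perm.sign σ • (List.ofFn fun r => L (v (σ r))).prod i j := by
  simp [wordForm, Form.homogeneous, ContinuousMultilinearMap.alternatization_apply_apply,
    wordEntry_apply]

theorem wordForm_apply_of_ne (L : E →L[ℝ] Matrix (Fin N) (Fin N) ℂ) {k l : ℕ} (h : l ≠ k)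
    (i j : Fin N) : wordForm L k i j l = 0 := by
  simp [wordForm, Form.homogeneous, Pi.single_eq_of_ne h]

theorem wordForm_zero (L : E →L[ℝ] Matrix (Fin N) (Fin N) ℂ) : wordForm L 0 = 1 := by
  ext i j k v
  have h0 : (1 : Matrix (Fin N) (Fin N) (Form E)) i j = Form.const ((1 : Matrix (Fin N) (Fin N) ℂ) i j) := by
    by_cases h : i = j
    · subst h; simp; rfl
    · simp only [Matrix.one_apply_ne h, Form.const]
      funext k
      by_cases hk : k = 0
      · subst hk; ext; simp [Form.homogeneous]
      · simp [Form.homogeneous, Pi.single_eq_of_ne hk]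
  rw [h0]
  by_cases hk : k = 0
  · subst hk
    rw [wordForm_apply_apply]
    simp [Form.const, Form.homogeneous]
  · rw [wordForm_apply_of_ne L hk]
    simp [Form.const, Form.homogeneous, Pi.single_eq_of_ne hk]

/-- The sum over the middle matrix index concatenates two words into one. All forms in the Chern
form of `g` are real multiples of word forms of a single `L`, so this rule replaces associativity of
the wedge product and any general algebra of forms. -/
theorem wordForm_mul (L : E →L[ℝ] Matrix (Fin N) (Fin N) ℂ) (p q : ℕ) :
    wordForm L p * wordForm L q = wordForm L (p + q) := by
  ext1 i j
  simp only [Matrix.mul_apply, wordForm, Matrix.of_apply, Form.homogeneous_mul,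
    Form.homogeneous_sum]
  congr 1
  ext v
  simp only [ContinuousAlternatingMap.sum_apply, wedge_alternatization,
    ContinuousMultilinearMap.alternatization_apply_apply]
  rw [Finset.sum_comm]
  refine Finset.sum_congr rfl fun π _ => ?_
  rw [← Finset.smul_sum]
  simp only [wordEntry_apply, ← Matrix.mul_apply, Function.comp_apply]
  rw [← List.prod_append, ← List.ofFn_fin_append]
  have : Fin.append (fun r => L (v (π (Fin.castAdd q r)))) (fun r => L (v (π (Fin.natAdd p r)))) =
      fun r => L (v (π r)) := by
    funext r
    induction r using Fin.addCases <;> simp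
  rw [this]

theorem smul_mul_smul_matrix (r s : ℝ) (A B : Matrix (Fin N) (Fin N) (Form E)) :
    (r • A) * (s • B) = (r * s) • (A * B) := by
  ext1 i j
  simp only [Matrix.mul_apply, Matrix.smul_apply, Form.smul_mul_smul, Finset.smul_sum]

theorem matPow_smul_wordForm (L : E →L[ℝ] Matrix (Fin N) (Fin N) ℂ) (r : ℝ) (k i : ℕ) :
    matPow (r • wordForm L k) i = r ^ i • wordForm L (k * i) := by
  induction i with
  | zero => simp [matPow, wordForm_zero]
  | succ i ih => rw [matPow, ih, smul_mul_smul_matrix, wordForm_mul, pow_succ, Nat.mul_succ]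

theorem map_const_mul_ofLinear (c : Matrix (Fin N) (Fin N) ℂ) (l : Fin N → Fin N → E →L[ℝ] ℂ)
    (L : E →L[ℝ] Matrix (Fin N) (Fin N) ℂ) (hL : ∀ v, L v = c * Matrix.of fun i j => l i j v) :
    c.map Form.const * Matrix.of (fun i j => Form.ofLinear (l i j)) = wordForm L 1 := by
  ext1 i j
  have h1 : ∀ (z : ℂ) (m : E →L[ℝ] ℂ), Form.const z * Form.ofLinear m =
      Form.homogeneous (ContinuousAlternatingMap.ofSubsingleton ℝ E ℂ (0 : Fin 1) (z • m)) := by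
    intro z m
    rw [Form.const, Form.ofLinear, Form.homogeneous_mul]
    funext k
    by_cases hk : k = 1
    · subst hk
      ext v
      have : wedge (rfl : 0 + 1 = 0 + 1) (ContinuousAlternatingMap.constOfIsEmpty ℝ E (Fin 0) z)
        (ContinuousAlternatingMap.ofSubsingleton ℝ E ℂ (0 : Fin 1) m) v = z * m (v 0) := by
        rw [wedge_apply]
        simp
      simpa [Form.homogeneous] using this
    · simp [Form.homogeneous, Pi.single_eq_of_ne hk]
  simp only [Matrix.mul_apply, Matrix.map_apply, Matrix.of_apply, h1, Form.homogeneous_sum, wordForm]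
  congr 1
  ext v
  simp only [ContinuousMultilinearMap.alternatization_apply_apply]
  simp [wordEntry_apply, hL, Matrix.mul_apply, Matrix.one_apply]

end Forms

/-! ### Exterior derivatives of one-forms `∑ a db` in charts with corners -/

section MaurerCartan

variable {E : Type*} [NormedAddCommGroup E] [NormedSpace ℝ E]

theorem two_le_infty : (1 + 1 : WithTop ℕ∞) ≤ ∞ := by
  rw [one_add_one_eq_two]
  exact WithTop.coe_le_coe.2 (le_top : (2 : ℕ∞) ≤ ⊤)

/-- `d (∑ₖ Aₖ dBₖ) = ∑ₖ dAₖ ∧ dBₖ`. -/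
theorem extDerivWithin_sum_smul_fderivWithin {ι : Type*} [Fintype ι] {A B : ι → E → ℂ} {s : Set E}
    {x : E} (hs : UniqueDiffOn ℝ s) (hx : x ∈ closure (interior s)) (hxs : x ∈ s)
    (hA : ∀ k, ContDiffWithinAt ℝ ∞ (A k) s x) (hB : ∀ k, ContDiffWithinAt ℝ ∞ (B k) s x)
    (v : Fin 2 → E) :
    extDerivWithin (fun y => ContinuousAlternatingMap.ofSubsingleton ℝ E ℂ (0 : Fin 1)
      (∑ k, A k y • fderivWithin ℝ (B k) s y)) s x v =
    ∑ k, (fderivWithin ℝ (A k) s x (v 0) * fderivWithin ℝ (B k) s x (v 1) -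
      fderivWithin ℝ (A k) s x (v 1) * fderivWithin ℝ (B k) s x (v 0)) := by
  have hux := hs x hxs
  have hdA : ∀ k, DifferentiableWithinAt ℝ (A k) s x := fun k =>
    (hA k).differentiableWithinAt (by simp)
  have hdB : ∀ k, DifferentiableWithinAt ℝ (fderivWithin ℝ (B k) s) s x := fun k =>
    ((hB k).fderivWithin_right (m := 1) hs two_le_infty hxs).differentiableWithinAt
      one_ne_zero
  have hsum : DifferentiableWithinAt ℝ (fun y => ∑ k, A k y • fderivWithin ℝ (B k) s y) s x :=
    DifferentiableWithinAt.fun_sum fun k _ => (hdA k).smul (hdB k)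
  have hω : DifferentiableWithinAt ℝ (fun y =>
      ContinuousAlternatingMap.ofSubsingleton ℝ E ℂ (0 : Fin 1)
        (∑ k, A k y • fderivWithin ℝ (B k) s y)) s x :=
    (ContinuousAlternatingMap.ofSubsingletonLIE (𝕜 := ℝ) (E := E) (F := ℂ)
      (0 : Fin 1)).toContinuousLinearEquiv.differentiableAt.comp_differentiableWithinAt x hsum
  have hD : ∀ u w : E, fderivWithin ℝ (fun y => ∑ k, A k y * fderivWithin ℝ (B k) s y w) s x u =
      ∑ k, (A k x * fderivWithin ℝ (fderivWithin ℝ (B k) s) s x u w +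
        fderivWithin ℝ (A k) s x u * fderivWithin ℝ (B k) s x w) := by
    intro u w
    have hBw : ∀ k, HasFDerivWithinAt (fun y => fderivWithin ℝ (B k) s y w)
        ((fderivWithin ℝ (fderivWithin ℝ (B k) s) s x).flip w) s x := fun k =>
      (hdB k).hasFDerivWithinAt.clm_apply (hasFDerivWithinAt_const w x s) |>.congr_fderiv (by
        ext; simp)
    have h := HasFDerivWithinAt.fun_sum (u := Finset.univ) fun k _ =>
      ((hdA k).hasFDerivWithinAt.mul (hBw k))
    refine (congrArg (fun l : E →L[ℝ] ℂ => l u) (h.fderivWithin hux)).trans ?_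
    simp [mul_comm]
  -- The terms with second derivatives of `B k` cancel by symmetry. At boundary points this symmetry
  -- holds because `x` lies in the closure of the interior of `s`.
  have hsymm : ∀ k, fderivWithin ℝ (fderivWithin ℝ (B k) s) s x (v 0) (v 1) =
      fderivWithin ℝ (fderivWithin ℝ (B k) s) s x (v 1) (v 0) := fun k =>
    ((hB k).isSymmSndFDerivWithinAt (by simpa [one_add_one_eq_two] using two_le_infty) hs hx hxs).eq _ _
  rw [extDerivWithin_apply hω hux]
  rw [Fin.sum_univ_two]
  simp only [ContinuousAlternatingMap.ofSubsingleton_apply_apply,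
    _root_.sum_apply, _root_.smul_apply, smul_eq_mul, hD]
  simp only [Fin.val_zero, pow_zero, one_smul, Fin.val_one, pow_one, neg_smul,
    ← sub_eq_add_neg, ← Finset.sum_sub_distrib]
  refine Finset.sum_congr rfl fun k _ => ?_
  simp [hsymm, Fin.removeNth]

variable {H : Type*} [TopologicalSpace H] {I : ModelWithCorners ℝ E H}
  {M : Type*} [TopologicalSpace M] [ChartedSpace H M]

variable (I) in
/-- The derivative of a complex-valued function, as a functional on the model space. -/
def scalarDeriv (c : M → ℂ) (p : M) : E →L[ℝ] ℂ :=
  mfderiv I 𝓘(ℝ, ℂ) c p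

theorem scalarDeriv_eq_fderivWithin {c : M → ℂ} {p : M} (hc : MDifferentiableAt I 𝓘(ℝ, ℂ) c p) :
    scalarDeriv I c p =
      fderivWithin ℝ (c ∘ (extChartAt I p).symm) (Set.range I) (extChartAt I p p) := by
  unfold scalarDeriv mfderiv
  exact if_pos hc

theorem extD_apply_eq_zero (η : M → Form E) (k : ℕ) (hη : ∀ q, η q k = 0) (p : M) :
    extD I η p (k + 1) = 0 := by
  have key : ∀ D : E → E →L[ℝ] E, extDerivWithin
      (fun y => (η ((extChartAt I p).symm y) k).compContinuousLinearMap (D y))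
      (Set.range I) (extChartAt I p p) = 0 := by
    intro D
    have : (fun y => (η ((extChartAt I p).symm y) k).compContinuousLinearMap (D y)) =
        fun _ => 0 := by
      funext y; rw [hη]; rfl
    rw [this, extDerivWithin, fderivWithin_fun_const]
    exact map_zero (ContinuousAlternatingMap.alternatizeUncurryFinCLM ℝ E ℂ)
  exact key _

variable [IsManifold I ∞ M]

/-- The chain rule: pulling `dc` back along the inverse chart gives the differential of the
coordinate expression of `c`. It reduces `extD` to a computation on the model space. -/
theorem fderivWithin_comp_extChartAt_symm {c : M → ℂ} (hc : ContMDiff I 𝓘(ℝ, ℂ) ∞ c) (p : M)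
    {y : E} (hy : y ∈ (extChartAt I p).target) (w : E) :
    fderivWithin ℝ (c ∘ (extChartAt I p).symm) (Set.range I) y w =
      scalarDeriv I c ((extChartAt I p).symm y)
        ((mfderivWithin 𝓘(ℝ, E) I (extChartAt I p).symm (Set.range I) y : E →L[ℝ] E) w) := by
  have h := mfderiv_comp_mfderivWithin y (g := c)
    ((hc _).mdifferentiableAt (by simp)) (mdifferentiableWithinAt_extChartAt_symm hy)
    (I.uniqueMDiffOn y (extChartAt_target_subset_range p hy))
  rw [mfderivWithin_eq_fderivWithin] at h
  exact congrArg (fun l : E →L[ℝ] ℂ => l w) h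

theorem extD_sum_smul_scalarDeriv {ι : Type*} [Fintype ι] {a b : ι → M → ℂ}
    (ha : ∀ k, ContMDiff I 𝓘(ℝ, ℂ) ∞ (a k)) (hb : ∀ k, ContMDiff I 𝓘(ℝ, ℂ) ∞ (b k))
    (η : M → Form E)
    (hη : ∀ q, η q 1 = ContinuousAlternatingMap.ofSubsingleton ℝ E ℂ (0 : Fin 1)
      (∑ k, a k q • scalarDeriv I (b k) q)) (p : M) (v : Fin 2 → E) :
    extD I η p 2 v =
      ∑ k, (scalarDeriv I (a k) p (v 0) * scalarDeriv I (b k) p (v 1) -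
        scalarDeriv I (a k) p (v 1) * scalarDeriv I (b k) p (v 0)) := by
  have hxs : extChartAt I p p ∈ Set.range I :=
    extChartAt_target_subset_range p (mem_extChartAt_target p)
  have hsm : ∀ c : M → ℂ, ContMDiff I 𝓘(ℝ, ℂ) ∞ c →
      ContDiffWithinAt ℝ ∞ (c ∘ (extChartAt I p).symm) (Set.range I) (extChartAt I p p) :=
    fun c hc => by
      have := (hc _).comp_contMDiffWithinAt _
        (contMDiffWithinAt_extChartAt_symm_range (n := ∞) (I := I) p (mem_extChartAt_target p))
      exact contMDiffWithinAt_iff_contDiffWithinAt.1 this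
  simp only [scalarDeriv_eq_fderivWithin ((ha _ p).mdifferentiableAt (by simp)),
    scalarDeriv_eq_fderivWithin ((hb _ p).mdifferentiableAt (by simp))]
  rw [← extDerivWithin_sum_smul_fderivWithin I.uniqueDiffOn (I.range_subset_closure_interior hxs)
    hxs (fun k => hsm _ (ha k)) (fun k => hsm _ (hb k)) v]
  change extDerivWithin _ _ _ v = _
  congr 1
  -- The coordinate formula holds only on the chart target, which is a neighbourhood of the base
  -- point within the range of `I`; that suffices for a derivative.
  refine Filter.EventuallyEq.extDerivWithin_eq_of_mem ?_ hxs
  filter_upwards [extChartAt_target_mem_nhdsWithin p] with y hy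
  have key : ∀ (ψ : E → M) (D : E →L[ℝ] E),
      (∀ k w, fderivWithin ℝ (b k ∘ ψ) (Set.range I) y w = scalarDeriv I (b k) (ψ y) (D w)) →
      (η (ψ y) 1).compContinuousLinearMap D =
        ContinuousAlternatingMap.ofSubsingleton ℝ E ℂ (0 : Fin 1)
          (∑ k, (a k ∘ ψ) y • fderivWithin ℝ (b k ∘ ψ) (Set.range I) y) := by
    intro ψ D hD
    ext w
    simp [hη, hD]
  exact key _ _ fun k w => fderivWithin_comp_extChartAt_symm (hb k) p hy w

end MaurerCartan

/-! ### Differential calculus of matrix-valued functions -/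

section MatrixCalculus

open Matrix

variable {E : Type*} [NormedAddCommGroup E] [NormedSpace ℝ E]
  {H : Type*} [TopologicalSpace H] {I : ModelWithCorners ℝ E H}
  {M : Type*} [TopologicalSpace M] [ChartedSpace H M]
  {E' : Type*} [NormedAddCommGroup E'] [NormedSpace ℝ E']
  {H' : Type*} [TopologicalSpace H'] {J : ModelWithCorners ℝ E' H'}
  {M' : Type*} [TopologicalSpace M'] [ChartedSpace H' M']
  {ι κ μ ν : Type*}

theorem contMDiff_mul_complex {c d : M → ℂ} (hc : ContMDiff I 𝓘(ℝ, ℂ) ∞ c)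
    (hd : ContMDiff I 𝓘(ℝ, ℂ) ∞ d) : ContMDiff I 𝓘(ℝ, ℂ) ∞ fun q => c q * d q :=
  (contDiff_mul (𝕜 := ℝ) (𝔸 := ℂ)).contMDiff.comp (hc.prodMk_space hd)

theorem scalarDeriv_const (c : ℂ) (p : M) : scalarDeriv I (fun _ => c) p = 0 := by
  unfold scalarDeriv
  exact mfderiv_const

theorem scalarDeriv_add {c d : M → ℂ} {p : M} (hc : MDifferentiableAt I 𝓘(ℝ, ℂ) c p)
    (hd : MDifferentiableAt I 𝓘(ℝ, ℂ) d p) :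
    scalarDeriv I (fun q => c q + d q) p = scalarDeriv I c p + scalarDeriv I d p :=
  (hc.hasMFDerivAt.add hd.hasMFDerivAt).mfderiv

theorem scalarDeriv_mul {c d : M → ℂ} {p : M} (hc : MDifferentiableAt I 𝓘(ℝ, ℂ) c p)
    (hd : MDifferentiableAt I 𝓘(ℝ, ℂ) d p) :
    scalarDeriv I (fun q => c q * d q) p = c p • scalarDeriv I d p + d p • scalarDeriv I c p :=
  (hc.hasMFDerivAt.mul hd.hasMFDerivAt).mfderiv

theorem scalarDeriv_sum {c : ι → M → ℂ} {p : M} (s : Finset ι)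
    (hc : ∀ k, MDifferentiableAt I 𝓘(ℝ, ℂ) (c k) p) :
    scalarDeriv I (fun q => ∑ k ∈ s, c k q) p = ∑ k ∈ s, scalarDeriv I (c k) p := by
  suffices h : MDifferentiableAt I 𝓘(ℝ, ℂ) (fun q => ∑ k ∈ s, c k q) p ∧
      scalarDeriv I (fun q => ∑ k ∈ s, c k q) p = ∑ k ∈ s, scalarDeriv I (c k) p from h.2
  induction s using Finset.cons_induction with
  | empty => simpa using ⟨mdifferentiableAt_const, scalarDeriv_const 0 p⟩
  | cons a s ha ih =>
    simp only [Finset.sum_cons]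
    exact ⟨(hc a).add ih.1, by rw [scalarDeriv_add (hc a) ih.1, ih.2]⟩

theorem scalarDeriv_star {c : M → ℂ} {p : M} (hc : MDifferentiableAt I 𝓘(ℝ, ℂ) c p) (v : E) :
    scalarDeriv I (fun q => star (c q)) p v = star (scalarDeriv I c p v) := by
  have h := mfderiv_comp p (g := Complex.conjCLE) (f := c)
    (Complex.conjCLE.differentiableAt.mdifferentiableAt) hc
  rw [mfderiv_eq_fderiv, ContinuousLinearEquiv.fderiv] at h
  exact congrArg (fun l : E →L[ℝ] ℂ => l v) h

theorem scalarDeriv_comp_fst {c : M → ℂ} {q : M × M'} (hc : MDifferentiableAt I 𝓘(ℝ, ℂ) c q.1)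
    (v : E × E') : scalarDeriv (I.prod J) (fun q : M × M' => c q.1) q v = scalarDeriv I c q.1 v.1 := by
  have h := mfderiv_comp q (g := c) (f := @Prod.fst M M') (I := I.prod J) hc mdifferentiableAt_fst
  rw [mfderiv_fst] at h
  exact congrArg (fun l : E × E' →L[ℝ] ℂ => l v) h

theorem scalarDeriv_comp_snd {c : M' → ℂ} {q : M × M'} (hc : MDifferentiableAt J 𝓘(ℝ, ℂ) c q.2)
    (v : E × E') : scalarDeriv (I.prod J) (fun q : M × M' => c q.2) q v = scalarDeriv J c q.2 v.2 := by
  have h := mfderiv_comp q (g := c) (f := @Prod.snd M M') (I := I.prod J) hc mdifferentiableAt_snd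
  rw [mfderiv_snd] at h
  exact congrArg (fun l : E × E' →L[ℝ] ℂ => l v) h

variable (I) in
/-- A matrix-valued function with smooth entries. -/
def MatSmooth (F : M → Matrix ι κ ℂ) : Prop :=
  ∀ i j, ContMDiff I 𝓘(ℝ, ℂ) ∞ fun q => F q i j

variable (I) in
/-- The directional derivative of a matrix-valued function. -/
def matDeriv (F : M → Matrix ι κ ℂ) (p : M) (v : E) : Matrix ι κ ℂ :=
  Matrix.of fun i j => scalarDeriv I (fun q => F q i j) p v

theorem MatSmooth.mdiff {F : M → Matrix ι κ ℂ} (hF : MatSmooth I F) (p : M) (i : ι) (j : κ) :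
    MDifferentiableAt I 𝓘(ℝ, ℂ) (fun q => F q i j) p :=
  (hF i j p).mdifferentiableAt (by simp)

theorem matSmooth_const (A : Matrix ι κ ℂ) : MatSmooth I fun _ : M => A :=
  fun _ _ => contMDiff_const

theorem matDeriv_const (A : Matrix ι κ ℂ) (p : M) (v : E) :
    matDeriv I (fun _ : M => A) p v = 0 := by
  ext i j
  simp [matDeriv, scalarDeriv_const]

theorem MatSmooth.mul [Fintype κ] {F : M → Matrix ι κ ℂ} {G : M → Matrix κ μ ℂ}
    (hF : MatSmooth I F) (hG : MatSmooth I G) : MatSmooth I fun q => F q * G q := fun i j => by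
  simp only [Matrix.mul_apply]
  exact ContMDiff.sum fun k _ => contMDiff_mul_complex (hF i k) (hG k j)

theorem matDeriv_mul [Fintype κ] {F : M → Matrix ι κ ℂ} {G : M → Matrix κ μ ℂ}
    (hF : MatSmooth I F) (hG : MatSmooth I G) (p : M) (v : E) :
    matDeriv I (fun q => F q * G q) p v = matDeriv I F p v * G p + F p * matDeriv I G p v := by
  ext i j
  simp only [matDeriv, Matrix.mul_apply, Matrix.of_apply, Matrix.add_apply]
  rw [scalarDeriv_sum (c := fun k q => F q i k * G q k j) _
    fun k => MDifferentiableAt.mul (hF.mdiff p i k) (hG.mdiff p k j)]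
  simp only [scalarDeriv_mul (hF.mdiff p _ _) (hG.mdiff p _ _), _root_.sum_apply,
    _root_.add_apply, _root_.smul_apply, smul_eq_mul, ← Finset.sum_add_distrib]
  exact Finset.sum_congr rfl fun k _ => by ring

theorem MatSmooth.conjTranspose {F : M → Matrix ι κ ℂ} (hF : MatSmooth I F) :
    MatSmooth I fun q => (F q)ᴴ := fun i j =>
  (Complex.conjCLE.contDiff (n := ∞)).contMDiff.comp (hF j i)

theorem matDeriv_conjTranspose {F : M → Matrix ι κ ℂ} (hF : MatSmooth I F) (p : M) (v : E) :
    matDeriv I (fun q => (F q)ᴴ) p v = (matDeriv I F p v)ᴴ := by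
  ext i j
  exact scalarDeriv_star (hF.mdiff p j i) v

theorem MatSmooth.fromBlocks {A : M → Matrix ι κ ℂ} {B : M → Matrix ι μ ℂ} {C : M → Matrix ν κ ℂ}
    {D : M → Matrix ν μ ℂ} (hA : MatSmooth I A) (hB : MatSmooth I B) (hC : MatSmooth I C)
    (hD : MatSmooth I D) :
    MatSmooth I fun q => Matrix.fromBlocks (A q) (B q) (C q) (D q) := by
  rintro (i | i) (j | j)
  exacts [hA i j, hB i j, hC i j, hD i j]

theorem matDeriv_fromBlocks (A : M → Matrix ι κ ℂ) (B : M → Matrix ι μ ℂ) (C : M → Matrix ν κ ℂ)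
    (D : M → Matrix ν μ ℂ) (p : M) (v : E) :
    matDeriv I (fun q => Matrix.fromBlocks (A q) (B q) (C q) (D q)) p v =
      Matrix.fromBlocks (matDeriv I A p v) (matDeriv I B p v) (matDeriv I C p v)
        (matDeriv I D p v) := by
  ext (i | i) (j | j) <;> rfl

theorem MatSmooth.submatrix {F : M → Matrix ι κ ℂ} (hF : MatSmooth I F) (e : μ → ι) (e' : ν → κ) :
    MatSmooth I fun q => (F q).submatrix e e' :=
  fun i j => hF (e i) (e' j)

theorem MatSmooth.smul_const {c : M → ℂ} (hc : ContMDiff I 𝓘(ℝ, ℂ) ∞ c) (A : Matrix ι κ ℂ) :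
    MatSmooth I fun q => c q • A :=
  fun i j => contMDiff_mul_complex hc (contMDiff_const (c := A i j))

theorem matDeriv_smul_const {c : M → ℂ} (hc : ContMDiff I 𝓘(ℝ, ℂ) ∞ c) (A : Matrix ι κ ℂ) (p : M)
    (v : E) : matDeriv I (fun q => c q • A) p v = scalarDeriv I c p v • A := by
  ext i j
  have := congrArg (fun l : E →L[ℝ] ℂ => l v)
    (scalarDeriv_mul (I := I) ((hc p).mdifferentiableAt (by simp))
    (mdifferentiableAt_const (c := A i j)))
  refine this.trans ?_
  simp [scalarDeriv_const, mul_comm]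

theorem MatSmooth.comp_fst {F : M → Matrix ι κ ℂ} (hF : MatSmooth I F) :
    MatSmooth (I.prod J) fun q : M × M' => F q.1 :=
  fun i j => (hF i j).comp contMDiff_fst

theorem MatSmooth.comp_snd {F : M' → Matrix ι κ ℂ} (hF : MatSmooth J F) :
    MatSmooth (I.prod J) fun q : M × M' => F q.2 :=
  fun i j => (hF i j).comp contMDiff_snd

theorem matDeriv_comp_fst {F : M → Matrix ι κ ℂ} (hF : MatSmooth I F) (q : M × M') (v : E × E') :
    matDeriv (I.prod J) (fun q : M × M' => F q.1) q v = matDeriv I F q.1 v.1 := by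
  ext i j
  exact scalarDeriv_comp_fst (hF.mdiff q.1 i j) v

theorem matDeriv_comp_snd {F : M' → Matrix ι κ ℂ} (hF : MatSmooth J F) (q : M × M') (v : E × E') :
    matDeriv (I.prod J) (fun q : M × M' => F q.2) q v = matDeriv J F q.2 v.2 := by
  ext i j
  exact scalarDeriv_comp_snd (hF.mdiff q.2 i j) v

theorem matDeriv_zero (F : M → Matrix ι κ ℂ) (p : M) : matDeriv I F p 0 = 0 := by
  ext i j
  simp [matDeriv]

/-- Differentiate `F⁻¹ F = 1`, with `F⁻¹` the conjugate transpose. This is the source of the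
Maurer-Cartan equation. -/
theorem matDeriv_conjTranspose_of_isometry [Fintype ι] [DecidableEq ι] {F : M → Matrix ι ι ℂ}
    (hF : MatSmooth I F) (h : ∀ q, (F q)ᴴ * F q = 1) (p : M) (v : E) :
    matDeriv I (fun q => (F q)ᴴ) p v = -((F p)ᴴ * matDeriv I F p v * (F p)ᴴ) := by
  have h' : F p * (F p)ᴴ = 1 := mul_eq_one_comm.1 (h p)
  have h1 := matDeriv_mul hF.conjTranspose hF p v
  simp only [h, matDeriv_const] at h1
  have h2 := congrArg (· * (F p)ᴴ) h1
  simp only [zero_mul, add_mul, mul_assoc, h', mul_one] at h2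
  rw [mul_assoc]
  exact eq_neg_of_add_eq_zero_left h2.symm

end MatrixCalculus

/-! ### The odd Chern form as traces of odd powers, and a vanishing criterion -/

section Chern

open Matrix

variable {E : Type*} [NormedAddCommGroup E] [NormedSpace ℝ E]
  {H : Type*} [TopologicalSpace H] {I : ModelWithCorners ℝ E H}
  {M : Type*} [TopologicalSpace M] [ChartedSpace H M] {N : ℕ}

/-- The matrix-valued one-form `g⁻¹ dg` of a map into `U(N)`. -/
def UMap.logDeriv (g : UMap I M N) (p : M) : E →L[ℝ] Matrix (Fin N) (Fin N) ℂ :=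
  ContinuousLinearMap.pi fun i => ContinuousLinearMap.pi fun j =>
    ∑ k, (((g p)⁻¹ : unitaryGroup (Fin N) ℂ) : Matrix (Fin N) (Fin N) ℂ) i k •
      scalarDeriv I (fun q => (g q : Matrix (Fin N) (Fin N) ℂ) k j) p

theorem UMap.logDeriv_apply (g : UMap I M N) (p : M) (v : E) :
    g.logDeriv p v = (g p : Matrix (Fin N) (Fin N) ℂ)ᴴ *
      matDeriv I (fun q => (g q : Matrix (Fin N) (Fin N) ℂ)) p v := by
  ext i j
  change (∑ k, (((g p)⁻¹ : unitaryGroup (Fin N) ℂ) : Matrix (Fin N) (Fin N) ℂ) i k •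
      scalarDeriv I (fun q => (g q : Matrix (Fin N) (Fin N) ℂ) k j) p) v = _
  rw [_root_.sum_apply]
  rfl

theorem UMap.mc_eq (g : UMap I M N) (p : M) : g.mc p = wordForm (g.logDeriv p) 1 :=
  map_const_mul_ofLinear (((g p)⁻¹ : unitaryGroup (Fin N) ℂ) : Matrix (Fin N) (Fin N) ℂ)
    (fun i j => scalarDeriv I (fun q => (g q : Matrix (Fin N) (Fin N) ℂ) i j) p) (g.logDeriv p)
    (g.logDeriv_apply p)

theorem smul_wordForm_apply_of_ne (L : E →L[ℝ] Matrix (Fin N) (Fin N) ℂ) (r : ℝ) {k l : ℕ}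
    (h : l ≠ k) (i j : Fin N) : (r • wordForm L k) i j l = 0 := by
  refine (congrArg (r • ·) (wordForm_apply_of_ne L h i j)).trans ?_
  ext v
  simp

theorem wordForm_one_apply (L : E →L[ℝ] Matrix (Fin N) (Fin N) ℂ) (i j : Fin N) (v : Fin 1 → E) :
    wordForm L 1 i j 1 v = L (v 0) i j := by
  rw [wordForm_apply_apply]
  simp

theorem wordForm_two_apply (L : E →L[ℝ] Matrix (Fin N) (Fin N) ℂ) (i j : Fin N) (v : Fin 2 → E) :
    wordForm L 2 i j 2 v = (L (v 0) * L (v 1)) i j - (L (v 1) * L (v 0)) i j := by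
  have h : (Finset.univ : Finset (Equiv.Perm (Fin 2))) = {1, Equiv.swap 0 1} := by decide
  rw [wordForm_apply_apply, h, Finset.sum_pair (by decide)]
  simp [sub_eq_add_neg]

theorem UMap.pathDeriv_smul_mc (g : UMap I M N) (s : ℝ) (p : M) :
    pathDeriv (fun s p => s • g.mc p) s p = wordForm (g.logDeriv p) 1 := by
  rw [← g.mc_eq]
  ext1 i j
  funext k
  change deriv (fun r : ℝ => r • g.mc p i j k) s = _
  simpa using ((hasDerivAt_id s).smul_const (g.mc p i j k)).deriv

theorem integral_smul_smul_form {k : ℕ} (c : ℂ) (r : ℝ → ℝ) (α : E [⋀^Fin k]→L[ℝ] ℂ) :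
    ∫ s in (0 : ℝ)..1, c • r s • α = (∫ s in (0 : ℝ)..1, c * (r s : ℂ)) • α := by
  refine Eq.trans ?_ (intervalIntegral.integral_smul_const (𝕜 := ℂ) (fun s => c * (r s : ℂ)) α)
  congr 1
  funext s
  rw [mul_smul]
  rfl

variable [IsManifold I ∞ M]

/-- The Maurer-Cartan equation `dω = -ω ∧ ω` for `ω = g⁻¹ dg`. -/
theorem UMap.extD_smul_mc (g : UMap I M N) (s : ℝ) (p : M) (i j : Fin N) :
    extD I (fun q => (s • g.mc q) i j) p = ((-s) • wordForm (g.logDeriv p) 2) i j := by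
  have hg : MatSmooth I fun q => (g q : Matrix (Fin N) (Fin N) ℂ) := g.smooth
  have hiso : ∀ q, (g q : Matrix (Fin N) (Fin N) ℂ)ᴴ * (g q : Matrix (Fin N) (Fin N) ℂ) = 1 :=
    fun q => mem_unitaryGroup_iff'.1 (g q).2
  funext k
  rcases k with _ | _ | _ | k
  · rw [smul_wordForm_apply_of_ne _ _ (by simp)]
    rfl
  · rw [smul_wordForm_apply_of_ne _ _ (by simp)]
    refine extD_apply_eq_zero _ 0 (fun q => ?_) p
    rw [g.mc_eq, smul_wordForm_apply_of_ne _ _ (by simp)]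
  · ext v
    rw [extD_sum_smul_scalarDeriv (a := fun k q => s • (g q : Matrix (Fin N) (Fin N) ℂ)ᴴ i k)
      (b := fun k q => (g q : Matrix (Fin N) (Fin N) ℂ) k j)]
    · have hd : ∀ k u, scalarDeriv I (fun q => s • (g q : Matrix (Fin N) (Fin N) ℂ)ᴴ i k) p u =
          -(s • (g.logDeriv p u * (g p : Matrix (Fin N) (Fin N) ℂ)ᴴ) i k) := by
        intro k u
        have h1 : scalarDeriv I (fun q => s • (g q : Matrix (Fin N) (Fin N) ℂ)ᴴ i k) p =
            s • scalarDeriv I (fun q => (g q : Matrix (Fin N) (Fin N) ℂ)ᴴ i k) p :=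
          const_smul_mfderiv (hg.conjTranspose.mdiff p i k) s
        have h2 := congrFun (congrFun (matDeriv_conjTranspose_of_isometry hg hiso p u) i) k
        rw [h1, _root_.smul_apply, g.logDeriv_apply, ← smul_neg]
        exact congrArg (s • ·) h2
      have hs : ∀ u w : E, ∑ k, (s • (g.logDeriv p u * (g p : Matrix (Fin N) (Fin N) ℂ)ᴴ) i k) *
            scalarDeriv I (fun q => (g q : Matrix (Fin N) (Fin N) ℂ) k j) p w =
          s • (g.logDeriv p u * g.logDeriv p w) i j := by
        intro u w
        rw [g.logDeriv_apply p w, ← mul_assoc, Matrix.mul_apply, Finset.smul_sum]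
        refine Finset.sum_congr rfl fun k _ => ?_
        rw [smul_mul_assoc]
        rfl
      simp only [hd, neg_mul, sub_neg_eq_add, Finset.sum_add_distrib, Finset.sum_neg_distrib, hs]
      rw [Matrix.smul_apply, Pi.smul_apply, ContinuousAlternatingMap.smul_apply,
        wordForm_two_apply, neg_smul, smul_sub]
      ring
    · exact fun k => (s • ContinuousLinearMap.id ℝ ℂ).contDiff.contMDiff.comp (hg.conjTranspose i k)
    · exact fun k => hg k j
    · intro q
      ext w
      rw [g.mc_eq, Matrix.smul_apply, Pi.smul_apply, ContinuousAlternatingMap.smul_apply,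
        wordForm_one_apply, g.logDeriv_apply,
        ContinuousAlternatingMap.ofSubsingleton_apply_apply, _root_.sum_apply, Matrix.mul_apply,
        Finset.smul_sum]
      refine Finset.sum_congr rfl fun k _ => ?_
      simp [matDeriv, mul_assoc]
  · rw [smul_wordForm_apply_of_ne _ _ (by simp)]
    refine extD_apply_eq_zero _ (k + 2) (fun q => ?_) p
    rw [g.mc_eq, smul_wordForm_apply_of_ne _ _ (by simp)]

/-- The term `s dω` contributes `-s ω²` by Maurer-Cartan, and `(s ω) ∧ (s ω)` contributes `s² ω²`.
-/
theorem UMap.curvature_smul_mc (g : UMap I M N) (s : ℝ) (p : M) :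
    curvature I (fun q => s • g.mc q) p = (s ^ 2 - s) • wordForm (g.logDeriv p) 2 := by
  have h : Matrix.of (fun i j => extD I (fun q => (s • g.mc q) i j) p) =
      (-s) • wordForm (g.logDeriv p) 2 := by
    ext1 i j
    exact g.extD_smul_mc s p i j
  simp only [curvature]
  rw [h, g.mc_eq, smul_mul_smul_matrix, wordForm_mul]
  refine (add_smul (-s) (s * s) (wordForm (g.logDeriv p) 2)).symm.trans ?_
  congr 1
  ring

/-- The integrand of the odd Chern form. -/
theorem UMap.Ch_integrand (g : UMap I M N) (s : ℝ) (p : M) (n : ℕ) :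
    ∑ i ∈ Finset.range (n + 1),
      matPow (curvature I (fun q => s • g.mc q) p) i * pathDeriv (fun s p => s • g.mc p) s p *
        matPow (curvature I (fun q => s • g.mc q) p) (n - i) =
    ((n + 1 : ℝ) * (s ^ 2 - s) ^ n) • wordForm (g.logDeriv p) (2 * n + 1) := by
  rw [g.pathDeriv_smul_mc, g.curvature_smul_mc]
  -- The position of `ω` among the factors `ω²` is immaterial: every summand concatenates to a word
  -- of length `2i + 1 + 2(n - i)`.
  have : ∀ i ∈ Finset.range (n + 1), matPow ((s ^ 2 - s) • wordForm (g.logDeriv p) 2) i *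
      wordForm (g.logDeriv p) 1 * matPow ((s ^ 2 - s) • wordForm (g.logDeriv p) 2) (n - i) =
      (s ^ 2 - s) ^ n • wordForm (g.logDeriv p) (2 * n + 1) := by
    intro i hi
    have hi' : i ≤ n := Nat.lt_succ_iff.1 (Finset.mem_range.1 hi)
    rw [matPow_smul_wordForm, matPow_smul_wordForm]
    conv_lhs => rw [← one_smul ℝ (wordForm (g.logDeriv p) 1)]
    rw [smul_mul_smul_matrix, smul_mul_smul_matrix, wordForm_mul, wordForm_mul, mul_one, ← pow_add,
      Nat.add_sub_cancel' hi']
    congr 2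
    omega
  rw [Finset.sum_congr rfl this, Finset.sum_const, Finset.card_range, ← Nat.cast_smul_eq_nsmul ℝ,
    smul_smul]
  push_cast
  rfl

theorem UMap.Ch_apply (g : UMap I M N) (p : M) (k : ℕ) :
    g.Ch p k = ∑ n ∈ Finset.range (k + 1),
      (∫ s in (0 : ℝ)..1, (1 / (2 * (Real.pi : ℂ) * Complex.I) ^ (n + 1) * (1 / ((n + 1)! : ℂ))) *
        (((n + 1 : ℝ) * (s ^ 2 - s) ^ n : ℝ) : ℂ)) •
      ∑ a, wordForm (g.logDeriv p) (2 * n + 1) a a k := by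
  simp only [UMap.Ch, connCS, Matrix.trace, Matrix.diag, g.Ch_integrand, Matrix.of_apply]
  rw [Finset.sum_apply]
  simp only [Matrix.sum_apply, Finset.sum_apply, Matrix.smul_apply, Pi.smul_apply]
  have h : ∀ a, (∫ s in (0 : ℝ)..1, ∑ n ∈ Finset.range (k + 1),
      (1 / (2 * (Real.pi : ℂ) * Complex.I) ^ (n + 1) * (1 / ((n + 1)! : ℂ))) •
        ((n + 1 : ℝ) * (s ^ 2 - s) ^ n) • wordForm (g.logDeriv p) (2 * n + 1) a a k) =
      ∑ n ∈ Finset.range (k + 1),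
      (∫ s in (0 : ℝ)..1, (1 / (2 * (Real.pi : ℂ) * Complex.I) ^ (n + 1) * (1 / ((n + 1)! : ℂ))) *
        (((n + 1 : ℝ) * (s ^ 2 - s) ^ n : ℝ) : ℂ)) •
      wordForm (g.logDeriv p) (2 * n + 1) a a k := by
    intro a
    rw [intervalIntegral.integral_finsetSum]
    · exact Finset.sum_congr rfl fun n _ => integral_smul_smul_form _ _ _
    · intro n _
      apply Continuous.intervalIntegrable
      fun_prop
  simp only [h]
  rw [Finset.sum_comm]
  simp only [Finset.smul_sum]

/-- In degree `k` only the summand with `k = 2n + 1` survives, so nothing is required for even `k`.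
For odd `k` the form is an alternating sum of traces of permuted words. -/
theorem UMap.Ch_apply_eq_zero (g : UMap I M N) (p : M) (k : ℕ) (u : Fin k → E)
    (h : ∀ (σ : Equiv.Perm (Fin k)), Odd k →
      ((List.ofFn σ).map fun r => g.logDeriv p (u r)).prod.trace = 0) :
    g.Ch p k u = 0 := by
  rw [g.Ch_apply, ContinuousAlternatingMap.sum_apply]
  refine Finset.sum_eq_zero fun n _ => ?_
  rw [ContinuousAlternatingMap.smul_apply, ContinuousAlternatingMap.sum_apply]
  by_cases hk : k = 2 * n + 1
  · subst hk
    simp only [wordForm_apply_apply]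
    rw [Finset.sum_comm]
    simp only [← Finset.smul_sum]
    rw [Finset.sum_eq_zero, smul_zero]
    intro σ _
    have := h σ ⟨n, rfl⟩
    rw [List.map_ofFn] at this
    exact (congrArg (Equiv.Perm.sign σ • ·) this).trans (smul_zero _)
  · simp [wordForm_apply_of_ne _ hk]

/-- A path `f` has vanishing odd Chern-Simons form if the integrand
`Tr (f⁻¹ ∂f/∂t (f⁻¹ df)^(2n))` vanishes. -/
theorem UPath.CS_eq_zero {a b : ℝ} [Fact (a < b)] (f : UPath I M a b N)
    (h : ∀ (q : M × Set.Icc a b) (w : EuclideanSpace ℝ (Fin 1)) (l : List E), Even l.length →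
      (UMap.logDeriv f q (0, w) * (l.map fun v => UMap.logDeriv f q (v, 0)).prod).trace = 0)
    (p : M) : f.CS p = 0 := by
  funext k
  have key : ∀ (q : M × Set.Icc a b) (w : EuclideanSpace ℝ (Fin 1)),
      ((UMap.Ch f q (k + 1)).curryLeft ((0, w) : E × EuclideanSpace ℝ (Fin 1))).compContinuousLinearMap
        (ContinuousLinearMap.inl ℝ E (EuclideanSpace ℝ (Fin 1))) = 0 := by
    intro q w
    ext v
    set u : Fin (k + 1) → E × EuclideanSpace ℝ (Fin 1) :=
      Matrix.vecCons (0, w) (ContinuousLinearMap.inl ℝ E (EuclideanSpace ℝ (Fin 1)) ∘ v) with hu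
    change UMap.Ch f q (k + 1) u = 0
    refine UMap.Ch_apply_eq_zero f q (k + 1) u fun σ hodd => ?_
    -- The letter `0`, which stands for `∂/∂t`, occurs exactly once in the word. Split the word
    -- there as `s, 0, t` and rotate it under the trace to `0, t, s`; the remaining `k` letters are
    -- tangent to `M`, and `k` is even because `k + 1` is odd.
    have hnd : (List.ofFn σ).Nodup := List.nodup_ofFn.2 σ.injective
    have hmem : (0 : Fin (k + 1)) ∈ List.ofFn σ := List.mem_ofFn.2 ⟨σ.symm 0, by simp⟩
    obtain ⟨s, t, hst⟩ := List.append_of_mem hmem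
    have hlen : s.length + t.length = k := by
      have := congrArg List.length hst
      simp at this
      omega
    rw [hst] at hnd ⊢
    have hne : ∀ r ∈ t ++ s, r ≠ 0 := by
      intro r hr h0
      subst h0
      have h1 := (List.nodup_append.1 hnd)
      rcases List.mem_append.1 hr with hr | hr
      · exact (List.nodup_cons.1 h1.2.1).1 hr
      · exact h1.2.2 _ hr _ List.mem_cons_self rfl
    have hmap : (t ++ s).map (fun r => UMap.logDeriv f q (u r)) =
        ((t ++ s).map fun r => (u r).1).map fun v => UMap.logDeriv f q (v, 0) := by
      rw [List.map_map]
      refine List.map_congr_left fun r hr => ?_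
      obtain ⟨r, rfl⟩ := Fin.exists_succ_eq.2 (hne r hr)
      simp [hu]
    rw [List.map_append, List.prod_append, Matrix.trace_mul_comm, List.map_cons, List.prod_cons,
      mul_assoc, ← List.prod_append, ← List.map_append, hmap]
    refine h q w _ ?_
    rw [List.length_map, List.length_append, add_comm, hlen]
    exact Nat.not_odd_iff_even.1 fun hk => Nat.not_even_iff_odd.2 hodd hk.add_one
  exact (intervalIntegral.integral_congr (g := fun _ => 0) fun t _ => key _ _).trans
    intervalIntegral.integral_zero

end Chern

/-! ### Block matrices and rotations between the two summands -/

section Blocks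

open Matrix

variable {E : Type*} [NormedAddCommGroup E] [NormedSpace ℝ E]
  {H : Type*} [TopologicalSpace H] {I : ModelWithCorners ℝ E H}
  {M : Type*} [TopologicalSpace M] [ChartedSpace H M]

theorem matrix_trace_submatrix_equiv {ι κ : Type*} [Fintype ι] [Fintype κ] (A : Matrix ι ι ℂ)
    (e : κ ≃ ι) : (A.submatrix e e).trace = A.trace := by
  simpa [Matrix.trace] using Equiv.sum_comp e fun i => A i i

/-- A map into `U(l + m)` given by its block matrices. -/
def UMap.ofBlocks {l m : ℕ} (F : M → Matrix (Fin l ⊕ Fin m) (Fin l ⊕ Fin m) ℂ) (hF : MatSmooth I F)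
    (hu : ∀ q, (F q)ᴴ * F q = 1) : UMap I M (l + m) where
  toFun q := ⟨(F q).submatrix finSumFinEquiv.symm finSumFinEquiv.symm, by
    rw [mem_unitaryGroup_iff', star_eq_conjTranspose, conjTranspose_submatrix,
      submatrix_mul_equiv, hu, submatrix_one_equiv]⟩
  smooth := hF.submatrix _ _

theorem UMap.logDeriv_ofBlocks {l m : ℕ} (F : M → Matrix (Fin l ⊕ Fin m) (Fin l ⊕ Fin m) ℂ)
    (hF : MatSmooth I F) (hu : ∀ q, (F q)ᴴ * F q = 1) (q : M) (v : E) :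
    (UMap.ofBlocks F hF hu).logDeriv q v =
      ((F q)ᴴ * matDeriv I F q v).submatrix finSumFinEquiv.symm finSumFinEquiv.symm := by
  rw [UMap.logDeriv_apply, ← submatrix_mul_equiv _ _ _ finSumFinEquiv.symm]
  rfl

theorem prod_map_conj {ι V : Type*} [Fintype ι] [DecidableEq ι] {U U' : Matrix ι ι ℂ}
    (hU : U' * U = 1) (A : V → Matrix ι ι ℂ) (l : List V) :
    (l.map fun v => U * A v * U').prod = U * (l.map A).prod * U' := by
  induction l with
  | nil => simpa using (mul_eq_one_comm.1 hU).symm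
  | cons v l ih =>
    rw [List.map_cons, List.prod_cons, ih, List.map_cons, List.prod_cons]
    calc U * A v * U' * (U * (l.map A).prod * U') =
        U * A v * (U' * U) * (l.map A).prod * U' := by simp only [mul_assoc]
      _ = _ := by rw [hU, mul_one, mul_assoc U]

theorem prod_map_submatrix_equiv {ι κ V : Type*} [Fintype ι] [DecidableEq ι] [Fintype κ]
    [DecidableEq κ] (e : κ ≃ ι) (A : V → Matrix ι ι ℂ) (l : List V) :
    (l.map fun v => (A v).submatrix e e).prod = (l.map A).prod.submatrix e e := by
  induction l with
  | nil => simp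
  | cons v l ih => simp [ih, submatrix_mul_equiv]

/-- The criterion `UPath.CS_eq_zero` for paths of block matrices, up to conjugation. -/
theorem UPath.CS_ofBlocks_eq_zero [IsManifold I ∞ M] {a b : ℝ} [Fact (a < b)] {l m : ℕ}
    (F : M × Set.Icc a b → Matrix (Fin l ⊕ Fin m) (Fin l ⊕ Fin m) ℂ)
    (hF : MatSmooth (I.prod (𝓡∂ 1)) F) (hu : ∀ q, (F q)ᴴ * F q = 1)
    (h : ∀ q, ∃ (U : Matrix (Fin l ⊕ Fin m) (Fin l ⊕ Fin m) ℂ)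
      (A : E → Matrix (Fin l ⊕ Fin m) (Fin l ⊕ Fin m) ℂ)
      (Z : EuclideanSpace ℝ (Fin 1) → Matrix (Fin l ⊕ Fin m) (Fin l ⊕ Fin m) ℂ),
      Uᴴ * U = 1 ∧ (∀ v, matDeriv (I.prod (𝓡∂ 1)) F q (v, 0) = F q * (U * A v * Uᴴ)) ∧
      (∀ w, matDeriv (I.prod (𝓡∂ 1)) F q (0, w) = F q * (U * Z w * Uᴴ)) ∧
      ∀ (w) (L : List E), Even L.length → (Z w * (L.map A).prod).trace = 0) (p : M) :
    UPath.CS (UMap.ofBlocks F hF hu : UPath I M a b (l + m)) p = 0 := by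
  refine UPath.CS_eq_zero _ (fun q w L hL => ?_) p
  obtain ⟨U, A, Z, hU, hA, hZ, htr⟩ := h q
  have hcancel : ∀ B, (F q)ᴴ * (F q * B) = B := fun B => by rw [← mul_assoc, hu, one_mul]
  simp only [UMap.logDeriv_ofBlocks, hA, hZ, hcancel]
  rw [prod_map_submatrix_equiv _ (fun v => U * A v * Uᴴ), submatrix_mul_equiv,
    matrix_trace_submatrix_equiv, prod_map_conj hU]
  rw [show U * Z w * Uᴴ * (U * (L.map A).prod * Uᴴ) = U * (Z w * (Uᴴ * U) * (L.map A).prod * Uᴴ) by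
    simp only [mul_assoc], hU, mul_one, trace_mul_comm, mul_assoc, hU, mul_one]
  exact htr w L hL

variable {α : Type*} [DecidableEq α]

/-! ### Rotations -/

/-- The rotation by the angle `u` in the plane of the two summands, twisted by `Q`. -/
def rot (Q : Matrix α α ℂ) (u : ℝ) : Matrix (α ⊕ α) (α ⊕ α) ℂ :=
  fromBlocks ((Real.cos u : ℂ) • 1) ((Real.sin u : ℂ) • -Qᴴ) ((Real.sin u : ℂ) • Q)
    ((Real.cos u : ℂ) • 1)

/-- The infinitesimal generator of `rot Q`. -/
def rotGen (Q : Matrix α α ℂ) : Matrix (α ⊕ α) (α ⊕ α) ℂ :=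
  fromBlocks 0 (-Qᴴ) Q 0

theorem rot_zero (Q : Matrix α α ℂ) : rot Q 0 = 1 := by
  simp [rot]

theorem rot_pi_div_two (Q : Matrix α α ℂ) : rot Q (Real.pi / 2) = rotGen Q := by
  simp [rot, rotGen]

theorem ofReal_cos_mul_self_add (u : ℝ) :
    (Real.cos u : ℂ) * Real.cos u + (Real.sin u : ℂ) * Real.sin u = 1 := by
  have := Real.cos_sq_add_sin_sq u
  rw [sq, sq] at this
  exact_mod_cast this

theorem rot_conjTranspose_mul_self [Fintype α] {Q : Matrix α α ℂ} (hQ : Qᴴ * Q = 1) (u : ℝ) :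
    (rot Q u)ᴴ * rot Q u = 1 := by
  have hQ' : Q * Qᴴ = 1 := mul_eq_one_comm.1 hQ
  have h := ofReal_cos_mul_self_add u
  simp only [rot, fromBlocks_conjTranspose, fromBlocks_multiply, conjTranspose_smul,
    conjTranspose_one, conjTranspose_neg, conjTranspose_conjTranspose, Complex.star_def,
    Complex.conj_ofReal, smul_mul_smul_comm, one_mul, mul_one, mul_neg, neg_mul, neg_neg, hQ, hQ',
    ← add_smul, h, smul_neg, mul_comm (Real.sin u : ℂ) (Real.cos u)]
  rw [add_comm ((Real.sin u : ℂ) * Real.sin u), h]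
  simp

theorem rot_mul_rotGen [Fintype α] {Q : Matrix α α ℂ} (hQ : Qᴴ * Q = 1) (u : ℝ) :
    rot Q u * rotGen Q = fromBlocks ((-Real.sin u : ℂ) • 1) ((Real.cos u : ℂ) • -Qᴴ)
      ((Real.cos u : ℂ) • Q) ((-Real.sin u : ℂ) • 1) := by
  have hQ' : Q * Qᴴ = 1 := mul_eq_one_comm.1 hQ
  simp [rot, rotGen, fromBlocks_multiply, hQ, hQ']

/-- The speed of the coordinate of `[a, b]` along a tangent vector. -/
def iccSpeed {a b : ℝ} [Fact (a < b)] (t : Set.Icc a b) (w : EuclideanSpace ℝ (Fin 1)) : ℝ :=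
  (mfderiv (𝓡∂ 1) 𝓘(ℝ, ℝ) (Subtype.val : Set.Icc a b → ℝ) t : EuclideanSpace ℝ (Fin 1) →L[ℝ] ℝ) w

section Icc

variable {a b : ℝ} [Fact (a < b)]

theorem contMDiff_ofReal_icc {u : ℝ → ℝ} (hu : ContDiff ℝ ∞ u) :
    ContMDiff (𝓡∂ 1) 𝓘(ℝ, ℂ) ∞ fun t : Set.Icc a b => (u t : ℂ) :=
  (Complex.ofRealCLM.contDiff.comp hu).contMDiff.comp contMDiff_subtypeVal_Icc

theorem scalarDeriv_ofReal_icc {u : ℝ → ℝ} {u' : ℝ} {t : Set.Icc a b}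
    (hu : HasDerivAt u u' t) (w : EuclideanSpace ℝ (Fin 1)) :
    scalarDeriv (𝓡∂ 1) (fun t : Set.Icc a b => (u t : ℂ)) t w = ((u' * iccSpeed t w : ℝ) : ℂ) := by
  have hd : HasFDerivAt (fun s : ℝ => (u s : ℂ))
      (Complex.ofRealCLM.comp (ContinuousLinearMap.smulRight (1 : ℝ →L[ℝ] ℝ) u')) (t : ℝ) :=
    Complex.ofRealCLM.hasFDerivAt.comp (t : ℝ) hu.hasFDerivAt
  have h := mfderiv_comp t (g := fun s : ℝ => (u s : ℂ)) (f := (Subtype.val : Set.Icc a b → ℝ))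
    hd.differentiableAt.mdifferentiableAt
    ((contMDiff_subtypeVal_Icc (n := 1) t).mdifferentiableAt one_ne_zero)
  rw [mfderiv_eq_fderiv, hd.fderiv] at h
  refine (congrArg (fun l : EuclideanSpace ℝ (Fin 1) →L[ℝ] ℂ => l w) h).trans ?_
  rw [mul_comm]
  rfl

theorem matSmooth_rot (Q : Matrix α α ℂ) {ρ : ℝ → ℝ} (hρ : ContDiff ℝ ∞ ρ) :
    MatSmooth (𝓡∂ 1) fun t : Set.Icc a b => rot Q (ρ t) :=
  have hc := contMDiff_ofReal_icc (a := a) (b := b) (Real.contDiff_cos.comp hρ)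
  have hs := contMDiff_ofReal_icc (a := a) (b := b) (Real.contDiff_sin.comp hρ)
  .fromBlocks (.smul_const hc _) (.smul_const hs _) (.smul_const hs _) (.smul_const hc _)

theorem matDeriv_rot [Fintype α] {Q : Matrix α α ℂ} (hQ : Qᴴ * Q = 1) {ρ : ℝ → ℝ} (hρ : ContDiff ℝ ∞ ρ)
    (t : Set.Icc a b) (w : EuclideanSpace ℝ (Fin 1)) :
    matDeriv (𝓡∂ 1) (fun t : Set.Icc a b => rot Q (ρ t)) t w =
      ((deriv ρ t * iccSpeed t w : ℝ) : ℂ) • (rot Q (ρ t) * rotGen Q) := by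
  have hd : HasDerivAt ρ (deriv ρ t) t := (hρ.differentiable (by simp) t).hasDerivAt
  have hc := contMDiff_ofReal_icc (a := a) (b := b) (Real.contDiff_cos.comp hρ)
  have hs := contMDiff_ofReal_icc (a := a) (b := b) (Real.contDiff_sin.comp hρ)
  have hc' := scalarDeriv_ofReal_icc hd.cos w
  have hs' := scalarDeriv_ofReal_icc hd.sin w
  rw [rot_mul_rotGen hQ]
  simp only [rot]
  rw [matDeriv_fromBlocks, fromBlocks_smul]
  have key : ∀ (c : Set.Icc a b → ℂ) (A : Matrix α α ℂ) (z : ℂ),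
      ContMDiff (𝓡∂ 1) 𝓘(ℝ, ℂ) ∞ c →
      scalarDeriv (𝓡∂ 1) c t w = ((deriv ρ t * iccSpeed t w : ℝ) : ℂ) * z →
      matDeriv (𝓡∂ 1) (fun t => c t • A) t w = ((deriv ρ t * iccSpeed t w : ℝ) : ℂ) • z • A := by
    intro c A z h1 h2
    rw [matDeriv_smul_const h1, h2, mul_smul]
  have e1 : scalarDeriv (𝓡∂ 1) (fun t : Set.Icc a b => (Real.cos (ρ t) : ℂ)) t w =
      ((deriv ρ t * iccSpeed t w : ℝ) : ℂ) * -(Real.sin (ρ t) : ℂ) := by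
    rw [hc']; push_cast; ring
  have e2 : scalarDeriv (𝓡∂ 1) (fun t : Set.Icc a b => (Real.sin (ρ t) : ℂ)) t w =
      ((deriv ρ t * iccSpeed t w : ℝ) : ℂ) * (Real.cos (ρ t) : ℂ) := by
    rw [hs']; push_cast; ring
  rw [key (fun t => (Real.cos (ρ t) : ℂ)) _ _ hc e1, key (fun t => (Real.sin (ρ t) : ℂ)) _ _ hs e2,
    key (fun t => (Real.sin (ρ t) : ℂ)) _ _ hs e2]

end Icc

end Blocks

/-! ### Angles that move one after the other -/

section Angles

/-- A smooth function that rises from `0` to `π / 2` on the first half of `[a, b]`. -/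
def firstAngle (a b s : ℝ) : ℝ :=
  Real.pi / 2 * Real.smoothTransition (2 * ((s - a) / (b - a)))

/-- A smooth function that rises from `0` to `π / 2` on the second half of `[a, b]`. -/
def secondAngle (a b s : ℝ) : ℝ :=
  Real.pi / 2 * Real.smoothTransition (2 * ((s - a) / (b - a)) - 1)

variable (a b : ℝ)

theorem contDiff_firstAngle : ContDiff ℝ ∞ (firstAngle a b) :=
  contDiff_const.mul (Real.smoothTransition.contDiff.comp (by fun_prop))

theorem contDiff_secondAngle : ContDiff ℝ ∞ (secondAngle a b) :=
  contDiff_const.mul (Real.smoothTransition.contDiff.comp (by fun_prop))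

theorem firstAngle_left : firstAngle a b a = 0 := by
  simp [firstAngle]

theorem secondAngle_left : secondAngle a b a = 0 := by
  rw [secondAngle, Real.smoothTransition.zero_of_nonpos (by simp), mul_zero]

variable {a b}

/-- The second rotation moves only when the first has reached its quarter turn. This keeps the
logarithmic derivative of the composite rotation off-diagonal. -/
theorem deriv_secondAngle_eq_zero_or (s : ℝ) :
    deriv (secondAngle a b) s = 0 ∨ firstAngle a b s = Real.pi / 2 := by
  by_cases hs : 1 ≤ 2 * ((s - a) / (b - a))
  · right
    rw [firstAngle, Real.smoothTransition.one_of_one_le hs, mul_one]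
  · left
    have hev : secondAngle a b =ᶠ[nhds s] fun _ => 0 := by
      have hcont : Continuous fun s : ℝ => 2 * ((s - a) / (b - a)) := by fun_prop
      filter_upwards [hcont.continuousAt.eventually_lt continuousAt_const (not_le.1 hs)] with r hr
      rw [secondAngle, Real.smoothTransition.zero_of_nonpos (by linarith), mul_zero]
    rw [hev.deriv_eq, deriv_const]

variable [Fact (a < b)]

theorem firstAngle_right : firstAngle a b b = Real.pi / 2 := by
  have : b - a ≠ 0 := sub_ne_zero.2 (Fact.out : a < b).ne'
  rw [firstAngle, div_self this, Real.smoothTransition.one_of_one_le (by norm_num), mul_one]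

theorem secondAngle_right : secondAngle a b b = Real.pi / 2 := by
  have : b - a ≠ 0 := sub_ne_zero.2 (Fact.out : a < b).ne'
  rw [secondAngle, div_self this, Real.smoothTransition.one_of_one_le (by norm_num), mul_one]

end Angles

/-! ### Equality in the stable unitary group -/

section Stable

open Matrix

theorem stable_blockSum_one {l m : ℕ} (x : unitaryGroup (Fin (l + m)) ℂ)
    (y : unitaryGroup (Fin l) ℂ)
    (h : (x : Matrix (Fin (l + m)) (Fin (l + m)) ℂ) =
      (fromBlocks (y : Matrix (Fin l) (Fin l) ℂ) 0 0 1).submatrix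
        finSumFinEquiv.symm finSumFinEquiv.symm) :
    stable x = stable y := by
  ext i j
  simp only [stable, of_apply, h, submatrix_apply]
  have hlt : ∀ (i : ℕ) (hi : i < l), finSumFinEquiv.symm (⟨i, by omega⟩ : Fin (l + m)) =
      Sum.inl ⟨i, hi⟩ := fun i hi => finSumFinEquiv_symm_apply_castAdd (⟨i, hi⟩ : Fin l)
  have hge : ∀ (i : ℕ) (hi : l ≤ i) (hi' : i < l + m), finSumFinEquiv.symm (⟨i, hi'⟩ : Fin (l + m)) =
      Sum.inr ⟨i - l, by omega⟩ := fun i hi hi' => by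
    have h1 := finSumFinEquiv_symm_apply_natAdd (m := l) (⟨i - l, by omega⟩ : Fin m)
    have h2 : Fin.natAdd l (⟨i - l, by omega⟩ : Fin m) = ⟨i, hi'⟩ := by
      ext
      simp
      omega
    rwa [h2] at h1
  by_cases hi : i < l <;> by_cases hj : j < l
  · rw [dif_pos ⟨by omega, by omega⟩, dif_pos ⟨hi, hj⟩, hlt i hi, hlt j hj, fromBlocks_apply₁₁]
  · rw [dif_neg (c := i < l ∧ j < l) (by tauto), if_neg (by omega : i ≠ j)]
    split_ifs with h'
    · rw [hlt i hi, hge j (by omega) h'.2]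
      rfl
    · rfl
  · rw [dif_neg (c := i < l ∧ j < l) (by tauto), if_neg (by omega : i ≠ j)]
    split_ifs with h'
    · rw [hge i (by omega) h'.1, hlt j hj]
      rfl
    · rfl
  · rw [dif_neg (c := i < l ∧ j < l) (by tauto)]
    split_ifs with h' he he
    · subst he
      rw [hge i (by omega) h'.1, fromBlocks_apply₂₂, one_apply_eq]
    · rw [hge i (by omega) h'.1, hge j (by omega) h'.2, fromBlocks_apply₂₂, one_apply_ne]
      simp only [ne_eq, Fin.mk.injEq]
      omega
    · rfl
    · rfl

theorem stable_congr {l m : ℕ} (h : l = m) (x : unitaryGroup (Fin l) ℂ)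
    (y : unitaryGroup (Fin m) ℂ)
    (hxy : (x : Matrix (Fin l) (Fin l) ℂ) =
      (y : Matrix (Fin m) (Fin m) ℂ).submatrix (finCongr h) (finCongr h)) :
    stable x = stable y := by
  subst h
  congr 1
  exact Subtype.ext hxy

theorem stable_one (l m : ℕ) :
    stable (1 : unitaryGroup (Fin l) ℂ) = stable (1 : unitaryGroup (Fin m) ℂ) := by
  have key : ∀ l : ℕ, stable (1 : unitaryGroup (Fin l) ℂ) = 1 := by
    intro l
    ext i j
    by_cases hij : i = j
    · subst hij
      simp [stable]
    · simp [stable, hij, one_apply]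
  rw [key, key]

theorem coe_blockSum {n m : ℕ} (x : unitaryGroup (Fin n) ℂ) (y : unitaryGroup (Fin m) ℂ) :
    (blockSum x y : Matrix (Fin (n + m)) (Fin (n + m)) ℂ) =
      (fromBlocks (x : Matrix (Fin n) (Fin n) ℂ) 0 0 (y : Matrix (Fin m) (Fin m) ℂ)).submatrix
        finSumFinEquiv.symm finSumFinEquiv.symm :=
  rfl

/-- The permutation of indices that exchanges the two summands of a block sum. -/
def blockSwap (n m : ℕ) : Fin (n + m) ≃ Fin (n + m) :=
  (finCongr (add_comm n m)).trans
    (finSumFinEquiv.symm.trans ((Equiv.sumComm _ _).trans finSumFinEquiv))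

theorem blockSum_submatrix_blockSwap {n m : ℕ} (x : unitaryGroup (Fin n) ℂ)
    (y : unitaryGroup (Fin m) ℂ) :
    (blockSum x y : Matrix (Fin (n + m)) (Fin (n + m)) ℂ).submatrix (blockSwap n m) (blockSwap n m) =
      (blockSum y x : Matrix (Fin (m + n)) (Fin (m + n)) ℂ).submatrix
        (finCongr (add_comm n m)) (finCongr (add_comm n m)) := by
  ext i j
  simp only [coe_blockSum, submatrix_apply, blockSwap, Equiv.trans_apply, Equiv.symm_apply_apply]
  rcases finSumFinEquiv.symm (finCongr (add_comm n m) i) with i | i <;>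
    rcases finSumFinEquiv.symm (finCongr (add_comm n m) j) with j | j <;> rfl

end Stable

/-! ### The two paths with vanishing Chern-Simons form -/

section Paths

open Matrix

variable {E : Type*} [NormedAddCommGroup E] [NormedSpace ℝ E]
  {H : Type*} [TopologicalSpace H] {I : ModelWithCorners ℝ E H}
  {M : Type*} [TopologicalSpace M] [ChartedSpace H M]
  {a b : ℝ} [Fact (a < b)] {l : ℕ}

theorem isometry_mul {ι : Type*} [Fintype ι] [DecidableEq ι] {A B : Matrix ι ι ℂ}
    (hA : Aᴴ * A = 1) (hB : Bᴴ * B = 1) : (A * B)ᴴ * (A * B) = 1 := by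
  rw [conjTranspose_mul, mul_assoc, ← mul_assoc Aᴴ, hA, one_mul, hB]

theorem isometry_conjTranspose {ι : Type*} [Fintype ι] [DecidableEq ι] {A : Matrix ι ι ℂ}
    (hA : Aᴴ * A = 1) : Aᴴᴴ * Aᴴ = 1 := by
  rw [conjTranspose_conjTranspose]
  exact mul_eq_one_comm.1 hA

theorem isometry_fromBlocks {ι κ : Type*} [Fintype ι] [DecidableEq ι] [Fintype κ] [DecidableEq κ]
    {A : Matrix ι ι ℂ} {B : Matrix κ κ ℂ} (hA : Aᴴ * A = 1) (hB : Bᴴ * B = 1) :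
    (fromBlocks A 0 0 B)ᴴ * fromBlocks A 0 0 B = 1 := by
  simp [fromBlocks_conjTranspose, fromBlocks_multiply, hA, hB]

theorem UMap.isometry (g : UMap I M l) (p : M) :
    (g p : Matrix (Fin l) (Fin l) ℂ)ᴴ * (g p : Matrix (Fin l) (Fin l) ℂ) = 1 :=
  mem_unitaryGroup_iff'.1 (g p).2

/-- The path of constant matrices that conjugates `g ⊕ 1` first to `1 ⊕ Q g Q⁻¹` and then to
`Q g Q⁻¹ ⊕ 1`. -/
def conjRot (Q : Matrix (Fin l) (Fin l) ℂ) (a b s : ℝ) : Matrix (Fin l ⊕ Fin l) (Fin l ⊕ Fin l) ℂ :=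
  rot (-1) (secondAngle a b s) * rot Q (firstAngle a b s)

theorem conjRot_left (Q : Matrix (Fin l) (Fin l) ℂ) (a b : ℝ) : conjRot Q a b a = 1 := by
  rw [conjRot, firstAngle_left, secondAngle_left, rot_zero, rot_zero, mul_one]

theorem conjRot_right (Q : Matrix (Fin l) (Fin l) ℂ) : conjRot Q a b b = fromBlocks Q 0 0 Qᴴ := by
  rw [conjRot, firstAngle_right, secondAngle_right, rot_pi_div_two, rot_pi_div_two]
  simp [rotGen, fromBlocks_multiply]

theorem isometry_conjRot {Q : Matrix (Fin l) (Fin l) ℂ} (hQ : Qᴴ * Q = 1) (a b s : ℝ) :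
    (conjRot Q a b s)ᴴ * conjRot Q a b s = 1 :=
  isometry_mul (rot_conjTranspose_mul_self (by simp) _) (rot_conjTranspose_mul_self hQ _)

theorem matSmooth_conjRot (Q : Matrix (Fin l) (Fin l) ℂ) :
    MatSmooth (𝓡∂ 1) fun t : Set.Icc a b => conjRot Q a b t :=
  (matSmooth_rot _ (contDiff_secondAngle a b)).mul (matSmooth_rot _ (contDiff_firstAngle a b))

/-- The logarithmic derivative of `conjRot Q` is block off-diagonal. -/
theorem matDeriv_conjRot {Q : Matrix (Fin l) (Fin l) ℂ} (hQ : Qᴴ * Q = 1) (t : Set.Icc a b)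
    (w : EuclideanSpace ℝ (Fin 1)) :
    ∃ z₁ z₂, matDeriv (𝓡∂ 1) (fun t : Set.Icc a b => conjRot Q a b t) t w =
      conjRot Q a b t * fromBlocks 0 z₁ z₂ 0 := by
  have hQ' : Q * Qᴴ = 1 := mul_eq_one_comm.1 hQ
  have h1 : (-1 : Matrix (Fin l) (Fin l) ℂ)ᴴ * -1 = 1 := by simp
  simp only [conjRot]
  rw [matDeriv_mul (matSmooth_rot _ (contDiff_secondAngle a b))
    (matSmooth_rot _ (contDiff_firstAngle a b)), matDeriv_rot h1 (contDiff_secondAngle a b),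
    matDeriv_rot hQ (contDiff_firstAngle a b)]
  generalize ((deriv (firstAngle a b) t * iccSpeed t w : ℝ) : ℂ) = τ
  rcases deriv_secondAngle_eq_zero_or (a := a) (b := b) t with h | h
  · refine ⟨τ • -Qᴴ, τ • Q, ?_⟩
    rw [h, zero_mul, Complex.ofReal_zero, zero_smul, zero_mul, zero_add,
      show fromBlocks 0 (τ • -Qᴴ) (τ • Q) 0 = τ • rotGen Q by simp [rotGen, fromBlocks_smul]]
    simp only [mul_smul_comm, mul_assoc]
  · generalize ((deriv (secondAngle a b) t * iccSpeed t w : ℝ) : ℂ) = υ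
    -- The first rotation now equals `rotGen Q`, so the logarithmic derivative of the product is `υ
    -- (rotGen Q)⁻¹ rotGen (-1) rotGen Q + τ rotGen Q`. A product of three off-diagonal matrices is
    -- off-diagonal; its blocks are `Qᴴ Qᴴ` and `-Q Q`.
    refine ⟨υ • (Qᴴ * Qᴴ) + τ • -Qᴴ, υ • -(Q * Q) + τ • Q, ?_⟩
    rw [h, rot_pi_div_two, show fromBlocks 0 (υ • (Qᴴ * Qᴴ) + τ • -Qᴴ) (υ • -(Q * Q) + τ • Q) 0 =
      υ • fromBlocks 0 (Qᴴ * Qᴴ) (-(Q * Q)) 0 + τ • rotGen Q by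
        simp [rotGen, fromBlocks_smul, fromBlocks_add]]
    have : rotGen Q * fromBlocks 0 (Qᴴ * Qᴴ) (-(Q * Q)) 0 = rotGen (-1) * rotGen Q := by
      simp [rotGen, fromBlocks_multiply, ← mul_assoc, hQ, hQ']
    rw [mul_add, mul_smul_comm, mul_smul_comm, mul_assoc, this, smul_mul_assoc, mul_smul_comm]
    simp only [mul_assoc]

/-- The path is `X D X⁻¹` with `D = g ⊕ 1`. Since `X` ends at `Q ⊕ Q⁻¹`, its endpoint is `Q g Q⁻¹ ⊕
1`. The doubling provides the room in which `X` can move with off-diagonal velocity. -/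
theorem exists_path_conj [IsManifold I ∞ M] (g : UMap I M l) {Q : Matrix (Fin l) (Fin l) ℂ}
    (hQ : Qᴴ * Q = 1) (g' : M → unitaryGroup (Fin l) ℂ)
    (hg' : ∀ p, (g' p : Matrix (Fin l) (Fin l) ℂ) = Q * (g p : Matrix (Fin l) (Fin l) ℂ) * Qᴴ) :
    ∃ f : UPath I M a b (l + l), f.StartsAt g ∧
      (∀ p, stable (f (p, ⟨b, (Fact.out : a < b).le, le_rfl⟩)) = stable (g' p)) ∧
      ∀ p, f.CS p = 0 := by
  set X : ℝ → Matrix (Fin l ⊕ Fin l) (Fin l ⊕ Fin l) ℂ := conjRot Q a b with hX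
  set D : M → Matrix (Fin l ⊕ Fin l) (Fin l ⊕ Fin l) ℂ :=
    fun p => fromBlocks (g p : Matrix (Fin l) (Fin l) ℂ) 0 0 1 with hD
  have hXs : MatSmooth (𝓡∂ 1) fun t : Set.Icc a b => X t := matSmooth_conjRot Q
  have hDs : MatSmooth I D :=
    .fromBlocks g.smooth (matSmooth_const _) (matSmooth_const _) (matSmooth_const _)
  have hXu : ∀ s, (X s)ᴴ * X s = 1 := isometry_conjRot hQ a b
  have hDu : ∀ p, (D p)ᴴ * D p = 1 := fun p => isometry_fromBlocks (g.isometry p) (by simp)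
  have hDu' : ∀ p, D p * (D p)ᴴ = 1 := fun p => mul_eq_one_comm.1 (hDu p)
  have hX1 : MatSmooth (I.prod (𝓡∂ 1)) fun q : M × Set.Icc a b => X q.2 := hXs.comp_snd
  have hD1 : MatSmooth (I.prod (𝓡∂ 1)) fun q : M × Set.Icc a b => D q.1 := hDs.comp_fst
  refine ⟨UMap.ofBlocks (fun q : M × Set.Icc a b => X q.2 * D q.1 * (X q.2)ᴴ)
    ((hX1.mul hD1).mul hX1.conjTranspose)
    (fun q => isometry_mul (isometry_mul (hXu _) (hDu _)) (isometry_conjTranspose (hXu _))), ?_, ?_,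
    UPath.CS_ofBlocks_eq_zero _ _ _ fun q => ?_⟩
  · intro p
    apply stable_blockSum_one
    change (X a * D p * (X a)ᴴ).submatrix _ _ = _
    rw [hX, conjRot_left]
    simp [hD]
  · intro p
    apply stable_blockSum_one
    change (X b * D p * (X b)ᴴ).submatrix _ _ = _
    rw [hX, conjRot_right, hg']
    simp [hD, fromBlocks_conjTranspose, fromBlocks_multiply, hQ]
  · choose z₁ z₂ hz using fun w => matDeriv_conjRot (a := a) (b := b) hQ q.2 w
    -- With `Z = X⁻¹ X'`, conjugation by `X` turns the space derivative into `D⁻¹ dD`, which is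
    -- block diagonal, and the time derivative into `D⁻¹ Z D + Zᴴ`, which is off-diagonal along with
    -- `Z`.
    refine ⟨X q.2, fun v => (D q.1)ᴴ * matDeriv I D q.1 v,
      fun w => (D q.1)ᴴ * fromBlocks 0 (z₁ w) (z₂ w) 0 * D q.1 + (fromBlocks 0 (z₁ w) (z₂ w) 0)ᴴ,
      hXu _, fun v => ?_, fun w => ?_, fun w L hL => ?_⟩
    · rw [matDeriv_mul (hX1.mul hD1) hX1.conjTranspose, matDeriv_mul hX1 hD1,
        matDeriv_conjTranspose hX1, matDeriv_comp_snd hXs, matDeriv_comp_fst hDs, matDeriv_zero]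
      have e : ∀ A B C : Matrix (Fin l ⊕ Fin l) (Fin l ⊕ Fin l) ℂ, A * B * Aᴴ * (A * (Bᴴ * C) * Aᴴ) =
          A * (B * ((Aᴴ * A) * Bᴴ) * C) * Aᴴ := fun A B C => by simp only [mul_assoc]
      rw [e, hXu, one_mul, hDu', one_mul]
      simp
    · rw [matDeriv_mul (hX1.mul hD1) hX1.conjTranspose, matDeriv_mul hX1 hD1,
        matDeriv_conjTranspose hX1, matDeriv_comp_snd hXs, matDeriv_comp_fst hDs, matDeriv_zero]
      rw [show matDeriv (𝓡∂ 1) (fun t : Set.Icc a b => X t) q.2 w = _ from hz w]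
      change (X q.2 * _ * D q.1 + _) * _ + _ * (X q.2 * _)ᴴ = _
      beta_reduce
      generalize fromBlocks 0 (z₁ w) (z₂ w) 0 = Z
      have e : ∀ A B : Matrix (Fin l ⊕ Fin l) (Fin l ⊕ Fin l) ℂ,
          A * B * Aᴴ * (A * (Bᴴ * Z * B + Zᴴ) * Aᴴ) =
          A * (B * (Aᴴ * A) * Bᴴ) * Z * B * Aᴴ + A * (B * (Aᴴ * A)) * Zᴴ * Aᴴ := fun A B => by
        simp only [mul_assoc, mul_add, add_mul]
      rw [e, hXu, mul_one, hDu', mul_one, conjTranspose_mul, mul_zero, add_zero]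
      simp only [mul_assoc]
    · have hprod : ∃ d₁ d₂, (L.map fun v => (D q.1)ᴴ * matDeriv I D q.1 v).prod =
          fromBlocks d₁ 0 0 d₂ := by
        clear hL
        induction L with
        | nil => exact ⟨1, 1, by simp⟩
        | cons v L ih =>
          obtain ⟨d₁, d₂, h⟩ := ih
          rw [List.map_cons, List.prod_cons, h, hD, matDeriv_fromBlocks]
          simp [matDeriv_const, fromBlocks_conjTranspose, fromBlocks_multiply]
      obtain ⟨d₁, d₂, h⟩ := hprod
      rw [h]
      simp only [hD, fromBlocks_conjTranspose, fromBlocks_multiply, fromBlocks_add]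
      simp [Matrix.trace]

/-- The matrix `X⁻¹ (Ω ⊕ 0) X - (0 ⊕ Ω)` for the rotation `X = rot 1 u`. -/
def skewRot (u : ℝ) (Ω : Matrix (Fin l) (Fin l) ℂ) : Matrix (Fin l ⊕ Fin l) (Fin l ⊕ Fin l) ℂ :=
  (Real.cos u : ℂ) • fromBlocks ((Real.cos u : ℂ) • Ω) (-((Real.sin u : ℂ) • Ω))
    (-((Real.sin u : ℂ) • Ω)) (-((Real.cos u : ℂ) • Ω))

theorem rot_one_mul_skewRot (u : ℝ) (Ω : Matrix (Fin l) (Fin l) ℂ) :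
    fromBlocks Ω 0 0 0 * rot 1 u + rot 1 u * fromBlocks 0 0 0 (-Ω) = rot 1 u * skewRot u Ω := by
  have h := ofReal_cos_mul_self_add u
  simp only [rot, skewRot]
  generalize (Real.cos u : ℂ) = c at *
  generalize (Real.sin u : ℂ) = s at *
  ext (i | i) (j | j)
  · simp [fromBlocks_multiply, fromBlocks_smul]
    linear_combination (-c * Ω i j) * h
  · simp [fromBlocks_multiply, fromBlocks_smul]
    ring
  · simp [fromBlocks_multiply, fromBlocks_smul]
    ring
  · simp [fromBlocks_multiply, fromBlocks_smul]
    linear_combination (c * Ω i j) * h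

/-- Up to the factor `cos u`, `skewRot u Ω` is `Ω` tensored with a 2 × 2 reflection matrix, and a
reflection squares to the identity. -/
theorem skewRot_mul_skewRot (u : ℝ) (Ω Ω' : Matrix (Fin l) (Fin l) ℂ) :
    skewRot u Ω * skewRot u Ω' = fromBlocks (((Real.cos u : ℂ) * Real.cos u) • (Ω * Ω')) 0 0
      (((Real.cos u : ℂ) * Real.cos u) • (Ω * Ω')) := by
  have h := ofReal_cos_mul_self_add u
  simp only [skewRot]
  generalize (Real.cos u : ℂ) = c at *
  generalize (Real.sin u : ℂ) = s at *
  ext (i | i) (j | j)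
  · simp [fromBlocks_multiply, fromBlocks_smul]
    linear_combination (c * c * (Ω * Ω') i j) * h
  · simp [fromBlocks_multiply, fromBlocks_smul]
    ring
  · simp [fromBlocks_multiply, fromBlocks_smul]
    ring
  · simp [fromBlocks_multiply, fromBlocks_smul]
    linear_combination (c * c * (Ω * Ω') i j) * h

/-- The quarter turn carries `1 ⊕ g⁻¹` to `g⁻¹ ⊕ 1`, which the constant-in-time factor `g ⊕ 1`
cancels. -/
theorem exists_path_blockSum_inv [IsManifold I ∞ M] (g : UMap I M l) :
    ∃ k : UPath I M a b (l + l), k.StartsAt (g.blockSum g.inv) ∧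
      k.EndsAt (UMap.one (I := I) (M := M) 0) ∧ ∀ p, k.CS p = 0 := by
  set X : ℝ → Matrix (Fin l ⊕ Fin l) (Fin l ⊕ Fin l) ℂ := fun s => rot 1 (firstAngle a b s) with hX
  set G : M → Matrix (Fin l ⊕ Fin l) (Fin l ⊕ Fin l) ℂ :=
    fun p => fromBlocks (g p : Matrix (Fin l) (Fin l) ℂ) 0 0 1 with hG
  set D : M → Matrix (Fin l ⊕ Fin l) (Fin l ⊕ Fin l) ℂ :=
    fun p => fromBlocks 1 0 0 (g p : Matrix (Fin l) (Fin l) ℂ)ᴴ with hD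
  have hgs : MatSmooth I fun p => (g p : Matrix (Fin l) (Fin l) ℂ) := g.smooth
  have hgu' : ∀ p, (g p : Matrix (Fin l) (Fin l) ℂ) * (g p : Matrix (Fin l) (Fin l) ℂ)ᴴ = 1 :=
    fun p => mul_eq_one_comm.1 (g.isometry p)
  have h1 : (1 : Matrix (Fin l) (Fin l) ℂ)ᴴ * 1 = 1 := by simp
  have hXs : MatSmooth (𝓡∂ 1) fun t : Set.Icc a b => X t :=
    matSmooth_rot _ (contDiff_firstAngle a b)
  have hGs : MatSmooth I G :=
    .fromBlocks hgs (matSmooth_const _) (matSmooth_const _) (matSmooth_const _)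
  have hDs : MatSmooth I D :=
    .fromBlocks (matSmooth_const _) (matSmooth_const _) (matSmooth_const _) hgs.conjTranspose
  have hXu : ∀ s, (X s)ᴴ * X s = 1 := fun s => rot_conjTranspose_mul_self h1 _
  have hGu : ∀ p, (G p)ᴴ * G p = 1 := fun p => isometry_fromBlocks (g.isometry p) h1
  have hDu : ∀ p, (D p)ᴴ * D p = 1 :=
    fun p => isometry_fromBlocks h1 (isometry_conjTranspose (g.isometry p))
  have hDu' : ∀ p, D p * (D p)ᴴ = 1 := fun p => mul_eq_one_comm.1 (hDu p)
  have hX1 : MatSmooth (I.prod (𝓡∂ 1)) fun q : M × Set.Icc a b => X q.2 := hXs.comp_snd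
  have hG1 : MatSmooth (I.prod (𝓡∂ 1)) fun q : M × Set.Icc a b => G q.1 := hGs.comp_fst
  have hD1 : MatSmooth (I.prod (𝓡∂ 1)) fun q : M × Set.Icc a b => D q.1 := hDs.comp_fst
  refine ⟨UMap.ofBlocks (fun q : M × Set.Icc a b => G q.1 * (X q.2 * D q.1 * (X q.2)ᴴ))
    (hG1.mul ((hX1.mul hD1).mul hX1.conjTranspose))
    (fun q => isometry_mul (hGu _)
      (isometry_mul (isometry_mul (hXu _) (hDu _)) (isometry_conjTranspose (hXu _)))), ?_, ?_,
    UPath.CS_ofBlocks_eq_zero _ _ _ fun q => ?_⟩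
  · intro p
    congr 1
    apply Subtype.ext
    change (G p * (X a * D p * (X a)ᴴ)).submatrix _ _ = (fromBlocks _ _ _ _).submatrix _ _
    rw [hX]
    simp only [firstAngle_left, rot_zero]
    simp [hG, hD, fromBlocks_multiply]
    rfl
  · intro p
    refine Eq.trans (congrArg stable ?_) (stable_one (l + l) 0)
    apply Subtype.ext
    change (G p * (X b * D p * (X b)ᴴ)).submatrix _ _ = 1
    rw [hX]
    simp only [firstAngle_right, rot_pi_div_two]
    simp [hG, hD, rotGen, fromBlocks_conjTranspose, fromBlocks_multiply, hgu']
  · set Ω : E → Matrix (Fin l) (Fin l) ℂ := fun v =>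
      (g q.1 : Matrix (Fin l) (Fin l) ℂ)ᴴ *
        matDeriv I (fun p => (g p : Matrix (Fin l) (Fin l) ℂ)) q.1 v with hΩ
    set A : E → Matrix (Fin l ⊕ Fin l) (Fin l ⊕ Fin l) ℂ := fun v =>
      skewRot (firstAngle a b q.2) (Ω v) with hA
    have hGD : ∀ v, matDeriv I G q.1 v = G q.1 * fromBlocks (Ω v) 0 0 0 := by
      intro v
      rw [hG, matDeriv_fromBlocks]
      simp [matDeriv_const, fromBlocks_multiply, hΩ, ← mul_assoc, hgu']
    have hDD : ∀ v, matDeriv I D q.1 v = fromBlocks 0 0 0 (-Ω v) * D q.1 := by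
      intro v
      rw [hD, matDeriv_fromBlocks, matDeriv_conjTranspose_of_isometry hgs g.isometry]
      simp [matDeriv_const, fromBlocks_multiply, hΩ]
    have hXA : ∀ v, fromBlocks (Ω v) 0 0 0 * X q.2 + X q.2 * fromBlocks 0 0 0 (-Ω v) =
        X q.2 * A v := fun v => rot_one_mul_skewRot _ _
    set τ : EuclideanSpace ℝ (Fin 1) → ℝ := fun w => deriv (firstAngle a b) q.2 * iccSpeed q.2 w
    -- Conjugating by `X D⁻¹` strips the outer factors of both derivatives. What remains is `X⁻¹ (Ω
    -- ⊕ 0) X - (0 ⊕ Ω)` in space and, as `X' = τ X B` with `B = rotGen 1` skew-Hermitian, `τ (B - D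
    -- B D⁻¹)` in time; the latter is off-diagonal because `D` is block diagonal.
    refine ⟨X q.2 * (D q.1)ᴴ, A, fun w => (τ w : ℂ) • (rotGen 1 - D q.1 * rotGen 1 * (D q.1)ᴴ),
      isometry_mul (hXu _) (isometry_conjTranspose (hDu _)), fun v => ?_, fun w => ?_,
      fun w L hL => ?_⟩
    · rw [matDeriv_mul hG1 ((hX1.mul hD1).mul hX1.conjTranspose),
        matDeriv_mul (hX1.mul hD1) hX1.conjTranspose, matDeriv_mul hX1 hD1,
        matDeriv_conjTranspose hX1, matDeriv_comp_snd hXs, matDeriv_comp_fst hDs,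
        matDeriv_comp_fst hGs, matDeriv_zero, hGD, hDD, conjTranspose_mul,
        conjTranspose_conjTranspose]
      have e : ∀ G X D A : Matrix (Fin l ⊕ Fin l) (Fin l ⊕ Fin l) ℂ,
          G * (X * D * Xᴴ) * (X * Dᴴ * A * (D * Xᴴ)) =
          G * (X * (D * (Xᴴ * X) * Dᴴ) * A * (D * Xᴴ)) := fun G X D A => by simp only [mul_assoc]
      rw [e, hXu, mul_one, hDu', mul_one, ← hXA]
      simp only [add_mul, mul_add, mul_assoc, conjTranspose_zero, mul_zero, zero_mul, add_zero,
        zero_add]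
    · rw [matDeriv_mul hG1 ((hX1.mul hD1).mul hX1.conjTranspose),
        matDeriv_mul (hX1.mul hD1) hX1.conjTranspose, matDeriv_mul hX1 hD1,
        matDeriv_conjTranspose hX1, matDeriv_comp_snd hXs, matDeriv_comp_fst hDs,
        matDeriv_comp_fst hGs, matDeriv_zero, matDeriv_zero, conjTranspose_mul,
        conjTranspose_conjTranspose]
      have hX' : matDeriv (𝓡∂ 1) (fun t : Set.Icc a b => X t) q.2 w =
        (τ w : ℂ) • (X q.2 * rotGen 1) := matDeriv_rot h1 (contDiff_firstAngle a b) q.2 w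
      have hB : (rotGen (1 : Matrix (Fin l) (Fin l) ℂ))ᴴ = -rotGen 1 := by
        simp [rotGen, fromBlocks_conjTranspose, fromBlocks_neg]
      rw [hX', conjTranspose_smul, conjTranspose_mul, hB, Complex.star_def, Complex.conj_ofReal]
      generalize rotGen (1 : Matrix (Fin l) (Fin l) ℂ) = B
      have e : ∀ G X D : Matrix (Fin l ⊕ Fin l) (Fin l ⊕ Fin l) ℂ,
          G * (X * D * Xᴴ) * (X * Dᴴ * ((τ w : ℂ) • (B - D * B * Dᴴ)) * (D * Xᴴ)) =
          (τ w : ℂ) • (G * (X * (D * (Xᴴ * X) * Dᴴ) * B * D * Xᴴ) -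
            G * (X * (D * (Xᴴ * X) * Dᴴ) * D * B * (Dᴴ * D) * Xᴴ)) := fun G X D => by
        simp only [mul_assoc, mul_smul_comm, smul_mul_assoc, mul_sub, sub_mul]
      rw [e, hXu, mul_one, hDu', mul_one, hDu, mul_one]
      simp only [mul_zero, zero_mul, zero_add, add_zero, mul_assoc, mul_add, smul_mul_assoc,
        mul_smul_comm, smul_add, neg_mul, mul_neg, smul_neg, sub_eq_add_neg]
    -- The induction removes two letters at a time, since one factor `A v` alone is in general not
    -- block diagonal.
    · have hprod : ∀ (n : ℕ) (L : List E), L.length = n + n → ∃ d₁ d₂,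
          (L.map A).prod = fromBlocks d₁ 0 0 d₂ := by
        intro n
        induction n with
        | zero =>
          intro L hL
          rw [List.length_eq_zero_iff.1 hL]
          exact ⟨1, 1, by simp⟩
        | succ n ih =>
          intro L hL
          match L, hL with
          | [v], hL => simp at hL; omega
          | v :: v' :: L, hL =>
            obtain ⟨d₁, d₂, h⟩ := ih L (by simp at hL; omega)
            rw [List.map_cons, List.map_cons, List.prod_cons, List.prod_cons, h, ← mul_assoc, skewRot_mul_skewRot]
            simp [fromBlocks_multiply]
      obtain ⟨n, hn⟩ := hL
      obtain ⟨d₁, d₂, h⟩ := hprod n L hn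
      rw [h]
      simp only [hD, rotGen, fromBlocks_conjTranspose, fromBlocks_multiply, fromBlocks_smul,
        sub_eq_add_neg, fromBlocks_neg, fromBlocks_add]
      simp [Matrix.trace]

end Paths

/-! ### Commutativity of the block sum -/

section BlockSumComm

open Matrix

theorem exists_path_blockSum_comm {E : Type*} [NormedAddCommGroup E] [NormedSpace ℝ E]
    {H : Type*} [TopologicalSpace H] {I : ModelWithCorners ℝ E H}
    {M : Type*} [TopologicalSpace M] [ChartedSpace H M] [IsManifold I ∞ M]
    {a b : ℝ} [Fact (a < b)] {n m : ℕ} (g : UMap I M n) (h : UMap I M m) :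
    ∃ (N : ℕ) (f : UPath I M a b N),
      f.StartsAt (g.blockSum h) ∧ f.EndsAt (h.blockSum g) ∧ ∀ p, f.CS p = 0 := by
  -- `Q` is the permutation matrix of the block exchange, so conjugation by it permutes rows and
  -- columns and turns `g ⊕ h` into `h ⊕ g`, up to the identification of `n + m` with `m + n`.
  set Q : Matrix (Fin (n + m)) (Fin (n + m)) ℂ :=
    (1 : Matrix (Fin (n + m)) (Fin (n + m)) ℂ).submatrix (blockSwap n m) id with hQ
  have hQu : Qᴴ * Q = 1 := by
    rw [mul_eq_one_comm, hQ, conjTranspose_submatrix, conjTranspose_one,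
      ← Equiv.coe_refl, submatrix_mul_equiv, mul_one, submatrix_one_equiv]
  have hconj : ∀ A : Matrix (Fin (n + m)) (Fin (n + m)) ℂ,
      Q * A * Qᴴ = A.submatrix (blockSwap n m) (blockSwap n m) := by
    intro A
    have h1 : Q * A = A.submatrix (blockSwap n m) id := by
      rw [hQ, ← Equiv.coe_refl, one_submatrix_mul]
      rfl
    rw [h1, hQ, conjTranspose_submatrix, conjTranspose_one, ← Equiv.coe_refl, mul_submatrix_one]
    rfl
  have hmem : ∀ p, Q * (g.blockSum h p : Matrix (Fin (n + m)) (Fin (n + m)) ℂ) * Qᴴ ∈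
      unitaryGroup (Fin (n + m)) ℂ := fun p =>
    mem_unitaryGroup_iff'.2
      (isometry_mul (isometry_mul hQu ((g.blockSum h).isometry p)) (isometry_conjTranspose hQu))
  obtain ⟨f, hf, hf', hCS⟩ := exists_path_conj (a := a) (b := b) (g.blockSum h) hQu
    (fun p => ⟨_, hmem p⟩) fun p => rfl
  refine ⟨_, f, hf, fun p => (hf' p).trans ?_, hCS⟩
  refine stable_congr (add_comm n m) _ _ ?_
  exact (hconj _).trans (blockSum_submatrix_blockSwap (g p) (h p))

end BlockSumComm

end OddK

end

theorem lemma3p5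
    {E : Type*} [NormedAddCommGroup E] [NormedSpace ℝ E] [FiniteDimensional ℝ E]
    {H : Type*} [TopologicalSpace H] (I : ModelWithCorners ℝ E H)
    {M : Type*} [TopologicalSpace M] [ChartedSpace H M] [IsManifold I ∞ M]
    [CompactSpace M] [T2Space M]
    (a b : ℝ) [Fact (a < b)] :
    (∀ (n m : ℕ) (g : OddK.UMap I M n) (h : OddK.UMap I M m),
      ∃ (N : ℕ) (f : OddK.UPath I M a b N),
        f.StartsAt (g.blockSum h) ∧ f.EndsAt (h.blockSum g) ∧ ∀ p, f.CS p = 0) ∧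
    (∀ (n : ℕ) (g : OddK.UMap I M n),
      ∃ (N : ℕ) (k : OddK.UPath I M a b N),
        k.StartsAt (g.blockSum g.inv) ∧ k.EndsAt (OddK.UMap.one (I := I) (M := M) 0) ∧
          ∀ p, k.CS p = 0) := by
  exact ⟨fun _ _ g h => OddK.exists_path_blockSum_comm g h,
    fun n g => ⟨n + n, OddK.exists_path_blockSum_inv g⟩⟩
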